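/- For an $N\times N$ Hermitian matrix $H$, an observable $O$ ($N\times N$ Hermitian, spectral norm $\|O\|$) and parameters $t>0$, $\gamma\in(0,1)$, $M\in\mathbb N$, let $$X_M(H)=\sum_{j=-M}^{M}c_j\,e^{-is_jH},\qquad s_j=j\,\delta_t\sqrt{2t},\quad c_j=\frac{\delta_t}{\sqrt{2\pi}}e^{-j^2\delta_t^2/2},\quad \delta_t=\Big(\sqrt{2t}+\sqrt{2\log(5/\gamma)}\Big)^{-1},$$ put $M_0=\big\lceil 2\big(\sqrt t+\sqrt{\log(5/\gamma)}\big)\sqrt{\log(4/\gamma)}\,\big\rceil$ and $\|c\|_1=\sum_{|j|\le M}c_j$. One *run* for $(O,M,|\psi_0\rangle)$ is the following quantum circuit with a single ancilla qubit. Prepare $|+\rangle|\psi_0\rangle$; draw $j_1,j_2\in\{-M,\dots,M\}$ independently, $j$ having probability $c_j/\|c\|_1$; apply $e^{-is_{j_1}H}$ to the system controlled on the ancilla being $|1\rangle$, then $e^{-is_{j_2}H}$ controlled on the ancilla being $|0\rangle$; measure $X\otimes O$ (Pauli $X$ on the ancilla). The maximal time of evolution of a run is $\max(|s_{j_1}|,|s_{j_2}|)$.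 *Single-Ancilla LCU* with $T$ runs per call sets $\mu=\frac{\|c\|_1^2}{T}\sum_{k=1}^T\mu_k$, where $\mu_1,\dots,\mu_T$ are the outcomes of $T$ independent runs, obtains $\tilde\ell$ in the same way from $T$ further independent runs with $O$ replaced by the identity, and outputs $\mu/\tilde\ell$. **Theorem.** For every $K>0$ there are constants $\kappa,C>0$, depending only on $K$, such that the following holds. Let $\varepsilon,\delta\in(0,1)$, $\eta\in(0,1/\sqrt2]$, $\Delta>0$, and let $O$ be an observable with $\|O\|\ge\varepsilon$. Let $\hat H$ be an $N\times N$ Hermitian matrix with ground energy $\lambda_0$ all of whose other eigenvalues are at least $\lambda_0+\Delta$, let $|\psi_0\rangle$ be a unit vector, and let $|v_0\rangle$ be a normalized ground state with $|\langle v_0|\psi_0\rangle|\ge\eta$ (if the ground space is degenerate, $|v_0\rangle$ is, up to a phase, the normalized projection of $|\psi_0\rangle$ onto it). Let $E_0$ and $\varepsilon_g$ satisfy $$|\lambda_0-E_0|\le\varepsilon_g\le\kappa\,\Delta\Big/\sqrt{\log\frac{\|O\|}{\varepsilon\eta}},$$ put $H=\hat H-(E_0-\varepsilon_g)I$, and assume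 that the spectrum of $H$ lies in $[0,1]$. Let $t$ satisfy $$\frac1{2\Delta^2}\log\frac{8\|O\|^2(1-\eta^2)}{\varepsilon^2\eta^2}\;\le\;t\;\le\;\frac{K}{\Delta^2}\log\frac{\|O\|}{\varepsilon\eta},\qquad\text{and put}\qquad\gamma=\frac{\varepsilon\eta^2}{30\|O\|}.$$ Then: 1. $\|X_{M_0}(H)-e^{-tH^2}\|\le\gamma$. 2. For every $M\le M_0$, the maximal time of evolution of $H$ in every run is at most $\tau_{\max}= \frac{C}{\Delta}\log\frac{\|O\|}{\varepsilon\eta}$. 3. For every $M$ with $\|X_M(H)-e^{-tH^2}\|\le\gamma$ and every integer $T\ge C\,\dfrac{\|O\|^2\ln(2/\delta)}{\varepsilon^2\eta^4}$, Single-Ancilla LCU for $(H,O,M,|\psi_0\rangle)$ with $T$ runs per call outputs, with probability at least $(1-\delta)^2$, numbers $\mu$ and $\tilde\ell\ne0$ with $$\left|\frac{\mu}{\tilde\ell}-\langle v_0|O|v_0\rangle\right|\le\varepsilon .$$ In particular, $T=O\big(\|O\|^2\ln(1/\delta)/(\varepsilon^2\eta^4)\big)$ runs suffice for $\delta\le1/2$,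 with one ancilla qubit. -/

import Mathlib

open Matrix
open scoped Kronecker ComplexOrder Matrix.Norms.L2Operator

noncomputable section

namespace SingleAncilla

/-! ### States, unitary evolution and projective measurement -/

/-- A density matrix on the Hilbert space with orthonormal basis `n`. -/
structure QState (n : Type) [Fintype n] where
  mat : Matrix n n ℂ
  posSemidef : mat.PosSemidef
  trace_eq_one : mat.trace = 1

section States

variable {m n : Type} [Fintype m] [Fintype n]

/-- The pure state `|ψ⟩⟨ψ|` of a unit vector. -/
def QState.ofVec (ψ : n → ℂ) (hψ : star ψ ⬝ᵥ ψ = 1) : QState n where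
  mat := vecMulVec ψ (star ψ)
  posSemidef := posSemidef_vecMulVec_self_star ψ
  trace_eq_one := by rw [trace_vecMulVec, dotProduct_comm, hψ]

/-- The product state `ρ ⊗ σ`. -/
def QState.tensor (ρ : QState m) (σ : QState n) : QState (m × n) where
  mat := ρ.mat ⊗ₖ σ.mat
  posSemidef := ρ.posSemidef.kronecker σ.posSemidef
  trace_eq_one := by rw [trace_kronecker, ρ.trace_eq_one, σ.trace_eq_one, one_mul]

/-- The state `U ρ U†`. -/
def QState.evolve [DecidableEq n] (ρ : QState n) (U : Matrix.unitaryGroup n ℂ) : QState n where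
  mat := U.1 * ρ.mat * U.1ᴴ
  posSemidef := ρ.posSemidef.mul_mul_conjTranspose_same U.1
  trace_eq_one := by
    have h : U.1ᴴ * U.1 = 1 := Matrix.mem_unitaryGroup_iff'.mp U.2
    rw [trace_mul_comm, ← Matrix.mul_assoc, h, Matrix.one_mul, ρ.trace_eq_one]

variable [DecidableEq n]

/-- The probability `⟨e_i|ρ|e_i⟩`, with `e_i` the vectors of an orthonormal eigenbasis of the
observable `A` (the columns of its eigenvector unitary). -/
def QState.eigenProb (ρ : QState n) {A : Matrix n n ℂ} (hA : A.IsHermitian) (i : n) : ℝ :=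
  (((hA.eigenvectorUnitary : Matrix n n ℂ)ᴴ * ρ.mat * (hA.eigenvectorUnitary : Matrix n n ℂ))
    i i).re

theorem QState.eigenProb_nonneg (ρ : QState n) {A : Matrix n n ℂ} (hA : A.IsHermitian) (i : n) :
    0 ≤ ρ.eigenProb hA i :=
  (Complex.nonneg_iff.mp
    (ρ.posSemidef.conjTranspose_mul_mul_same (hA.eigenvectorUnitary : Matrix n n ℂ)).diag_nonneg).1

theorem QState.sum_eigenProb (ρ : QState n) {A : Matrix n n ℂ} (hA : A.IsHermitian) :
    ∑ i, ρ.eigenProb hA i = 1 := by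
  have h : (hA.eigenvectorUnitary : Matrix n n ℂ) * (hA.eigenvectorUnitary : Matrix n n ℂ)ᴴ = 1 :=
    Matrix.mem_unitaryGroup_iff.mp hA.eigenvectorUnitary.2
  have h2 : ((hA.eigenvectorUnitary : Matrix n n ℂ)ᴴ * ρ.mat *
      (hA.eigenvectorUnitary : Matrix n n ℂ)).trace = 1 := by
    rw [trace_mul_comm, ← Matrix.mul_assoc, h, Matrix.one_mul, ρ.trace_eq_one]
  have h3 := congrArg Complex.re h2
  simpa [Matrix.trace, QState.eigenProb] using h3

/-- The law of the outcome of measuring the observable `A` in the state `ρ` (Born rule): the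
outcome is an eigenvalue of `A`, and `a` has probability `Tr (P_a ρ)` with `P_a` the orthogonal
projection onto the eigenspace of `a`. -/
def QState.measure (ρ : QState n) {A : Matrix n n ℂ} (hA : A.IsHermitian) : PMF ℝ :=
  (PMF.ofFintype (fun i => ENNReal.ofReal (ρ.eigenProb hA i)) (by
    rw [← ENNReal.ofReal_sum_of_nonneg (fun i _ => ρ.eigenProb_nonneg hA i), ρ.sum_eigenProb hA,
      ENNReal.ofReal_one])).map hA.eigenvalues

end States

/-- The one-qubit state `|+⟩⟨+|`. -/
def plusState : QState (Fin 2) :=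
  QState.ofVec (fun _ => ((1 / Real.sqrt 2 : ℝ) : ℂ)) (by
    have h : (1 / Real.sqrt 2 : ℝ) * (1 / Real.sqrt 2) = 1 / 2 := by
      rw [div_mul_div_comm, Real.mul_self_sqrt (by norm_num)]; norm_num
    simp only [dotProduct, Pi.star_apply, Fin.sum_univ_two, Complex.star_def, Complex.conj_ofReal,
      ← Complex.ofReal_mul, h]
    norm_num)

/-- The Pauli matrix `X`. -/
def pauliX : Matrix (Fin 2) (Fin 2) ℂ := !![0, 1; 1, 0]

section Circuits

variable {d : Type} [Fintype d] [DecidableEq d]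

theorem isHermitian_pauliX_kronecker {d : Type} {O : Matrix d d ℂ} (hO : O.IsHermitian) :
    (pauliX ⊗ₖ O).IsHermitian := by
  have hX : pauliXᴴ = pauliX := by
    ext i j; fin_cases i <;> fin_cases j <;> simp [pauliX]
  rw [Matrix.IsHermitian, conjTranspose_kronecker, hX, hO.eq]

/-! ### Hamiltonian evolution circuits with one ancilla qubit -/

/-- The time evolution operator `exp (- i s H)`. -/
def evolution (H : Matrix d d ℂ) (s : ℝ) : Matrix d d ℂ :=
  NormedSpace.exp ((-(Complex.I * (s : ℂ))) • H)

theorem evolution_mem {H : Matrix d d ℂ} (hH : H.IsHermitian) (s : ℝ) :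
    evolution H s ∈ Matrix.unitaryGroup d ℂ := by
  have h1 : (evolution H s)ᴴ = NormedSpace.exp (-((-(Complex.I * (s : ℂ))) • H)) := by
    rw [evolution, ← Matrix.exp_conjTranspose, conjTranspose_smul, hH.eq]
    congr 1
    rw [← neg_smul]
    congr 1
    simp
  have h2 : Commute ((-(Complex.I * (s : ℂ))) • H) (-((-(Complex.I * (s : ℂ))) • H)) :=
    (Commute.refl _).neg_right
  rw [Matrix.mem_unitaryGroup_iff, star_eq_conjTranspose, h1, evolution,
    ← Matrix.exp_add_of_commute _ _ h2, add_neg_cancel, NormedSpace.exp_zero]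

/-- The only gate of the model: the evolution `exp (- i s H)` of the system for the time
`s = time`, applied if the ancilla qubit is in the basis state `ctrl`. -/
structure CtrlEvolution where
  ctrl : Fin 2
  time : ℝ

/-- `|b⟩⟨b| ⊗ exp (- i s H) + (1 - |b⟩⟨b|) ⊗ 1` for the control value `b` and the time `s`. -/
def CtrlEvolution.mat (g : CtrlEvolution) (H : Matrix d d ℂ) : Matrix (Fin 2 × d) (Fin 2 × d) ℂ :=
  Matrix.single g.ctrl g.ctrl (1 : ℂ) ⊗ₖ evolution H g.time +
    (1 - Matrix.single g.ctrl g.ctrl (1 : ℂ)) ⊗ₖ (1 : Matrix d d ℂ)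

theorem CtrlEvolution.mat_mem (g : CtrlEvolution) {H : Matrix d d ℂ} (hH : H.IsHermitian) :
    g.mat H ∈ Matrix.unitaryGroup (Fin 2 × d) ℂ := by
  have hU : evolution H g.time * (evolution H g.time)ᴴ = 1 :=
    Matrix.mem_unitaryGroup_iff.mp (evolution_mem hH g.time)
  rw [Matrix.mem_unitaryGroup_iff, star_eq_conjTranspose, CtrlEvolution.mat, conjTranspose_add,
    conjTranspose_kronecker, conjTranspose_kronecker, conjTranspose_sub, conjTranspose_single,
    conjTranspose_one, conjTranspose_one, star_one, Matrix.mul_add, Matrix.add_mul, Matrix.add_mul,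
    ← mul_kronecker_mul, ← mul_kronecker_mul, ← mul_kronecker_mul, ← mul_kronecker_mul, hU]
  simp [Matrix.mul_sub, Matrix.sub_mul, ← add_kronecker]

/-- A circuit on one ancilla qubit and the system: the list of its gates in the order in which
they are applied. -/
abbrev Circuit := List CtrlEvolution

/-- The longest time for which a gate of the circuit evolves the Hamiltonian. -/
def Circuit.maxTime (c : Circuit) : ℝ := (c.map fun g => |g.time|).foldr max 0

/-- The state that the circuit produces from `ρ`. -/
def Circuit.apply (c : Circuit) {H : Matrix d d ℂ} (hH : H.IsHermitian) (ρ : QState (Fin 2 × d)) :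
    QState (Fin 2 × d) :=
  c.foldl (fun σ g => σ.evolve ⟨g.mat H, g.mat_mem hH⟩) ρ

end Circuits

/-! ### Linear combinations of time evolutions and the two algorithms -/

/-- The data `c_j > 0` and `s_j` of a linear combination of unitaries `∑ j, c_j exp (- i s_j H)`. -/
structure EvolutionLCU (ι : Type) where
  coeff : ι → ℝ
  coeff_pos : ∀ j, 0 < coeff j
  time : ι → ℝ

namespace EvolutionLCU

variable {ι : Type} [Fintype ι] [Nonempty ι] {d : Type} [Fintype d] [DecidableEq d]

/-- The norm `‖c‖₁ = ∑ j, c_j`. -/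
def l1 (L : EvolutionLCU ι) : ℝ := ∑ j, L.coeff j

/-- The operator `∑ j, c_j exp (- i s_j H)`. -/
def op (L : EvolutionLCU ι) (H : Matrix d d ℂ) : Matrix d d ℂ :=
  ∑ j, (L.coeff j : ℂ) • evolution H (L.time j)

theorem l1_pos (L : EvolutionLCU ι) : 0 < L.l1 :=
  Finset.sum_pos (fun j _ => L.coeff_pos j) Finset.univ_nonempty

/-- The law on indices in which `j` has probability `c_j / ‖c‖₁`. -/
def sample (L : EvolutionLCU ι) : PMF ι :=
  PMF.ofFintype (fun j => ENNReal.ofReal (L.coeff j / L.l1)) (by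
    rw [← ENNReal.ofReal_sum_of_nonneg
        (fun j _ => div_nonneg (L.coeff_pos j).le L.l1_pos.le), ← Finset.sum_div]
    have h : ∑ j, L.coeff j = L.l1 := rfl
    rw [h, div_self L.l1_pos.ne', ENNReal.ofReal_one])

/-- The circuit for the samples `V₁ = exp (- i s_{j₁} H)` and `V₂ = exp (- i s_{j₂} H)`: first
`V₁` controlled on `|1⟩`, then `V₂` controlled on `|0⟩`. -/
def circuit (L : EvolutionLCU ι) (j₁ j₂ : ι) : Circuit :=
  [⟨1, L.time j₁⟩, ⟨0, L.time j₂⟩]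

/-- The law of the outcome of one coherent run: draw `j₁`, `j₂` independently, run the circuit on
`|+⟩⟨+| ⊗ ρ₀`, and measure `X ⊗ O`. -/
def run (L : EvolutionLCU ι) {H : Matrix d d ℂ} (hH : H.IsHermitian) (ρ₀ : QState d)
    {O : Matrix d d ℂ} (hO : O.IsHermitian) : PMF ℝ :=
  L.sample.bind fun j₁ => L.sample.bind fun j₂ =>
    ((L.circuit j₁ j₂).apply hH (plusState.tensor ρ₀)).measure (isHermitian_pauliX_kronecker hO)

/-- The law of the output `(‖c‖₁² / T) ∑ k, μ_k` of the procedure `Expectation-observable`, where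
`μ_1, …, μ_T` are the outcomes of `T` independent runs. -/
def expectationObservable (L : EvolutionLCU ι) {H : Matrix d d ℂ} (hH : H.IsHermitian)
    (ρ₀ : QState d) {O : Matrix d d ℂ} (hO : O.IsHermitian) (T : ℕ) : MeasureTheory.Measure ℝ :=
  (MeasureTheory.Measure.pi fun _ : Fin T => (L.run hH ρ₀ hO).toMeasure).map
    fun x => L.l1 ^ 2 / T * ∑ k, x k

/-- The joint law of the outputs `(μ, ℓ)` of the procedure `Single-ancilla-LCU`: two independent
calls of `Expectation-observable` with `T` runs each, the first for the observable `O`, the second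
for the identity. Its final output is the quotient `μ / ℓ`. -/
def singleAncillaLCU (L : EvolutionLCU ι) {H : Matrix d d ℂ} (hH : H.IsHermitian)
    (ρ₀ : QState d) {O : Matrix d d ℂ} (hO : O.IsHermitian) (T : ℕ) :
    MeasureTheory.Measure (ℝ × ℝ) :=
  (L.expectationObservable hH ρ₀ hO T).prod
    (L.expectationObservable hH ρ₀ (O := (1 : Matrix d d ℂ)) Matrix.isHermitian_one T)

end EvolutionLCU

/-! ### The Gaussian linear combination of unitaries -/

/-- The step size `δ_t = (√(2t) + √(2 log (5/γ)))⁻¹`. -/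
def gaussStep (t γ : ℝ) : ℝ := (Real.sqrt (2 * t) + Real.sqrt (2 * Real.log (5 / γ)))⁻¹

theorem gaussStep_pos (t : ℝ) {γ : ℝ} (hγ : γ ∈ Set.Ioo (0 : ℝ) 1) : 0 < gaussStep t γ := by
  have h : 1 < 5 / γ := by
    rw [lt_div_iff₀ hγ.1]; linarith [hγ.2]
  have h2 : 0 < Real.sqrt (2 * Real.log (5 / γ)) :=
    Real.sqrt_pos.mpr (mul_pos two_pos (Real.log_pos h))
  exact inv_pos.mpr (add_pos_of_nonneg_of_pos (Real.sqrt_nonneg _) h2)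

/-- The truncation order `⌈2 (√t + √(log (5/γ))) √(log (4/γ))⌉`. -/
def gaussOrder (t γ : ℝ) : ℕ :=
  ⌈2 * (Real.sqrt t + Real.sqrt (Real.log (5 / γ))) * Real.sqrt (Real.log (4 / γ))⌉₊

/-- The indices `-M, …, M`. -/
abbrev GaussIndex (M : ℕ) : Type := {j : ℤ // j ∈ Finset.Icc (-(M : ℤ)) (M : ℤ)}

instance (M : ℕ) : Nonempty (GaussIndex M) := ⟨⟨0, by simp⟩⟩

/-- The linear combination `X_M = ∑_{j=-M}^{M} c_j exp (- i j δ_t √(2t) H)` with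
`c_j = δ_t / √(2π) · exp (- j² δ_t² / 2)`. -/
def gaussLCU (t : ℝ) {γ : ℝ} (hγ : γ ∈ Set.Ioo (0 : ℝ) 1) (M : ℕ) :
    EvolutionLCU (GaussIndex M) where
  coeff := fun j => gaussStep t γ / Real.sqrt (2 * Real.pi) *
    Real.exp (-((j.1 : ℝ) ^ 2 * gaussStep t γ ^ 2 / 2))
  coeff_pos _ := mul_pos (div_pos (gaussStep_pos t hγ) (Real.sqrt_pos.mpr Real.two_pi_pos))
    (Real.exp_pos _)
  time := fun j => (j.1 : ℝ) * gaussStep t γ * Real.sqrt (2 * t)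

/-! ### The ground state problem -/

section GroundState

/-- `v₀` is a ground state of `H` with ground energy `lam₀`, `Δ` is a lower bound on the gap
between `lam₀` and the other eigenvalues of `H`, and the projection of `ψ₀` onto the eigenspace of
`lam₀` is a multiple of `v₀`. The last condition holds for every `ψ₀` if the ground state is
non-degenerate; in the degenerate case it says which of the ground states `v₀` is. -/
structure IsGappedGroundState {d : Type} [Fintype d] [DecidableEq d]
    (H : Matrix d d ℂ) (lam₀ Δ : ℝ) (v₀ ψ₀ : d → ℂ) : Prop where
  unit : star v₀ ⬝ᵥ v₀ = 1
  eigen : H *ᵥ v₀ = (lam₀ : ℂ) • v₀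
  gap : ∀ lam : ℝ, lam ∈ spectrum ℝ H → lam = lam₀ ∨ lam₀ + Δ ≤ lam
  proj : ∀ w : d → ℂ, H *ᵥ w = (lam₀ : ℂ) • w → star v₀ ⬝ᵥ w = 0 → star w ⬝ᵥ ψ₀ = 0

/-- The shifted Hamiltonian `H - a`. -/
def shifted {d : Type} [DecidableEq d] (H : Matrix d d ℂ) (a : ℝ) : Matrix d d ℂ :=
  H - (a : ℂ) • (1 : Matrix d d ℂ)

theorem shifted_isHermitian {d : Type} [DecidableEq d] {H : Matrix d d ℂ} (hH : H.IsHermitian)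
    (a : ℝ) : (shifted H a).IsHermitian := by
  rw [Matrix.IsHermitian, shifted, conjTranspose_sub, conjTranspose_smul, conjTranspose_one, hH.eq]
  simp

end GroundState

end SingleAncilla

end

/-! The Gaussian filter `exp (-t A²)`, with `A` the shifted Hamiltonian, nearly leaves the ground
component alone and damps everything above the gap. Write `ψ = α v + w` with `v` the ground state
and `w` its orthogonal remainder. If `lam` is the ground energy of `A`, the filtered vector is `φ =
β v + R` with `β = exp (-t lam²) α`. Since `0 ≤ lam`, eigenvalues `x ≥ lam + Δ` satisfy `x² ≥ lam² +
Δ²`, so `R` carries the same factor `exp (-t lam²)` as `β` and an extra `exp (-t Δ²)`. The lower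
bound on `t` makes `‖R‖ / ‖β‖` at most of order `ε / ‖O‖`, and the choice of `κ` keeps `t lam² ≤
1/20`, so `‖φ‖²` is still of order `η²` (`IsGappedGroundState.norm_specFun_mulVec_le`,
`IsGappedGroundState.abs_div_sub_le`).

The filter is a Gaussian integral of time evolutions, discretized and truncated. On an eigenvalue of
`A` the discretization error is, by Poisson summation, a sum of shifted Gaussians (`tsum_gaussMode`,
`abs_tsum_exp_sub_le`), and the tail is a small multiple of the full sum
(`tsum_gaussWeight_compl_le`). Calculus in an eigenbasis turns these scalar bounds into an operator
bound (`norm_gaussLCU_op_sub_le`).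

For `X = ∑ c_j exp (-i s_j A)`, one run times `‖c‖₁²` is an unbiased estimate of `⟨ψ|X† O X|ψ⟩`
(`EvolutionLCU.integral_run`) with outcome bounded by `‖O‖`, so Hoeffding's inequality controls the
mean of `T` runs (`EvolutionLCU.expectationObservable_ge`). Taking the quotient by the estimate of
`‖Xψ‖²` removes the unknown normalization; `abs_div_sub_re_inner_le` adds up the errors from `R`,
from `X` and from sampling. -/

noncomputable section

namespace SingleAncilla

/-! ### The discretized Gaussian -/

/-- The weight `δ / √(2π) · exp (- j² δ² / 2)`. -/
def gaussWeight (δ : ℝ) (j : ℤ) : ℝ :=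
  δ / Real.sqrt (2 * Real.pi) * Real.exp (-((j : ℝ) ^ 2 * δ ^ 2 / 2))

/-- The Fourier mode of weight `gaussWeight δ j` and frequency `j δ`. -/
def gaussMode (δ y : ℝ) (j : ℤ) : ℂ :=
  (gaussWeight δ j : ℂ) * Complex.exp (-(Complex.I * ((j * δ * y : ℝ) : ℂ)))

theorem gaussWeight_pos {δ : ℝ} (hδ : 0 < δ) (j : ℤ) : 0 < gaussWeight δ j := by
  unfold gaussWeight; positivity

theorem norm_gaussMode {δ : ℝ} (hδ : 0 < δ) (y : ℝ) (j : ℤ) :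
    ‖gaussMode δ y j‖ = gaussWeight δ j := by
  have h : -(Complex.I * ((j * δ * y : ℝ) : ℂ)) = ((-(j * δ * y) : ℝ) : ℂ) * Complex.I := by
    push_cast; ring
  rw [gaussMode, norm_mul, h, Complex.norm_exp_ofReal_mul_I, mul_one, Complex.norm_real,
    Real.norm_of_nonneg (gaussWeight_pos hδ j).le]

/-- Up to a constant factor the weights are the norms of the terms of the Jacobi theta series at `z
= 0`, `τ = i δ² / (2π)`. -/
theorem summable_gaussWeight {δ : ℝ} (hδ : 0 < δ) : Summable (gaussWeight δ) := by
  have h := (hasSum_jacobiTheta₂_term 0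
    (τ := ((δ ^ 2 / (2 * Real.pi) : ℝ) : ℂ) * Complex.I)
    (by rw [Complex.mul_I_im, Complex.ofReal_re]; positivity)).summable.norm
  refine (h.mul_left (δ / Real.sqrt (2 * Real.pi))).congr fun j => ?_
  rw [gaussWeight, norm_jacobiTheta₂_term]
  congr 2
  have := Real.pi_ne_zero
  simp only [Complex.mul_I_im, Complex.ofReal_re, Complex.zero_im]
  field_simp
  ring

theorem summable_gaussMode {δ : ℝ} (hδ : 0 < δ) (y : ℝ) : Summable (gaussMode δ y) :=
  Summable.of_norm ((summable_gaussWeight hδ).congr fun j => (norm_gaussMode hδ y j).symm)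

/-- Poisson summation for the discretized Gaussian. -/
theorem tsum_gaussMode {δ : ℝ} (hδ : 0 < δ) (y : ℝ) :
    ∑' j, gaussMode δ y j =
      ((∑' k : ℤ, Real.exp (-((y + 2 * Real.pi * k / δ) ^ 2 / 2)) : ℝ) : ℂ) := by
  have hpi := Real.pi_pos
  have ha : 0 < δ ^ 2 / (2 * Real.pi) := by positivity
  -- The parameters `a`, `b` are fixed by `π a j² = j² δ² / 2` and `2π b j = -i j δ y`.
  have h := Complex.tsum_exp_neg_quadratic (a := ((δ ^ 2 / (2 * Real.pi) : ℝ) : ℂ))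
    (by rwa [Complex.ofReal_re]) (-(Complex.I * ((δ * y / (2 * Real.pi) : ℝ) : ℂ)))
  have hroot : ((δ ^ 2 / (2 * Real.pi) : ℝ) : ℂ) ^ (1 / 2 : ℂ)
      = ((δ / Real.sqrt (2 * Real.pi) : ℝ) : ℂ) := by
    rw [show (1 / 2 : ℂ) = ((1 / 2 : ℝ) : ℂ) by push_cast; rfl, ← Complex.ofReal_cpow ha.le,
      ← Real.sqrt_eq_rpow, Real.sqrt_div (by positivity), Real.sqrt_sq hδ.le]
  have hpiC : (Real.pi : ℂ) ≠ 0 := by exact_mod_cast hpi.ne'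
  have hδC : (δ : ℂ) ≠ 0 := by exact_mod_cast hδ.ne'
  have hl : ∀ j : ℤ, gaussMode δ y j = ((δ / Real.sqrt (2 * Real.pi) : ℝ) : ℂ) *
      Complex.exp (-Real.pi * ((δ ^ 2 / (2 * Real.pi) : ℝ) : ℂ) * j ^ 2 +
        2 * Real.pi * (-(Complex.I * ((δ * y / (2 * Real.pi) : ℝ) : ℂ))) * j) := by
    intro j
    rw [gaussMode, gaussWeight, Complex.ofReal_mul, Complex.ofReal_exp, mul_assoc,
      ← Complex.exp_add]
    congr 2
    push_cast
    field_simp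
  have hr : ∀ k : ℤ, Complex.exp (-Real.pi / ((δ ^ 2 / (2 * Real.pi) : ℝ) : ℂ) *
      (k + Complex.I * (-(Complex.I * ((δ * y / (2 * Real.pi) : ℝ) : ℂ)))) ^ 2) =
      ((Real.exp (-((y + 2 * Real.pi * k / δ) ^ 2 / 2)) : ℝ) : ℂ) := by
    intro k
    rw [Complex.ofReal_exp, mul_neg, ← mul_assoc, Complex.I_mul_I]
    congr 1
    push_cast
    field_simp
    ring
  simp_rw [hl, tsum_mul_left, h, hr, hroot, ← Complex.ofReal_tsum]
  have : ((δ / Real.sqrt (2 * Real.pi) : ℝ) : ℂ) ≠ 0 := by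
    exact_mod_cast (by positivity : 0 < δ / Real.sqrt (2 * Real.pi)).ne'
  field_simp

theorem hasSum_pow_natAbs {r : ℝ} (h0 : 0 ≤ r) (h1 : r < 1) :
    HasSum (fun k : ℤ => r ^ k.natAbs) ((1 - r)⁻¹ + r * (1 - r)⁻¹) := by
  refine HasSum.of_nat_of_neg_add_one ?_ ?_
  · simpa using hasSum_geometric_of_lt_one h0 h1
  · have : ∀ n : ℕ, r ^ (-((n : ℤ) + 1)).natAbs = r * r ^ n := fun n => by
      rw [Int.natAbs_neg, show ((n : ℤ) + 1).natAbs = n + 1 by omega, pow_succ']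
    simp_rw [this]
    exact (hasSum_geometric_of_lt_one h0 h1).mul_left r

/-- The aliasing error of a discretization with step `δ` resolving `y`. -/
theorem abs_tsum_exp_sub_le {δ y r : ℝ} (hδ : 0 < δ) (hr : 0 < r) (hr1 : r ≤ 1 / 5) (hy : 0 ≤ y)
    (hyδ : y + Real.sqrt (2 * Real.log r⁻¹) ≤ δ⁻¹) :
    |(∑' k : ℤ, Real.exp (-((y + 2 * Real.pi * k / δ) ^ 2 / 2))) - Real.exp (-(y ^ 2 / 2))|
      ≤ 5 / 2 * r := by
  have hpi := Real.pi_gt_three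
  have hlog : 0 ≤ Real.log r⁻¹ := Real.log_nonneg (by
    rw [le_inv_comm₀ one_pos hr]; linarith)
  set q := Real.sqrt (2 * Real.log r⁻¹) with hq
  have hq0 : 0 ≤ q := Real.sqrt_nonneg _
  have hqsq : q ^ 2 = 2 * Real.log r⁻¹ := Real.sq_sqrt (by positivity)
  have hterm : ∀ k : ℤ, k ≠ 0 →
      Real.exp (-((y + 2 * Real.pi * k / δ) ^ 2 / 2)) ≤ r ^ k.natAbs := by
    intro k hk
    have hk1 : (1 : ℝ) ≤ (k.natAbs : ℝ) := by exact_mod_cast Int.natAbs_pos.mpr hk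
    have habs : |(k : ℝ)| = (k.natAbs : ℝ) := by rw [Nat.cast_natAbs, Int.cast_abs]
    -- The alias `k ≠ 0` is centred at distance `2π|k|/δ ≥ |k| (y + q)` from the origin; since `|k|
    -- ≥ 1`, subtracting one `y` still leaves `|k| q`. As `exp (-q²/2) = r`, the alias is at most `r
    -- ^ |k|`, and the aliases form two geometric series.
    have h1 : (k.natAbs : ℝ) * q ≤ |y + 2 * Real.pi * k / δ| := by
      have h2 : |2 * Real.pi * k / δ| - |y| ≤ |y + 2 * Real.pi * k / δ| := by
        have := abs_sub_abs_le_abs_sub (2 * Real.pi * k / δ) (-y)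
        rwa [abs_neg, sub_neg_eq_add, add_comm _ y] at this
      have h3 : |2 * Real.pi * k / δ| = 2 * Real.pi * k.natAbs * δ⁻¹ := by
        rw [abs_div, abs_mul, habs, abs_of_pos hδ, abs_of_pos (by positivity), div_eq_mul_inv]
      rw [h3, abs_of_nonneg hy] at h2
      have h4 : (k.natAbs : ℝ) * (y + q) ≤ k.natAbs * δ⁻¹ := by gcongr
      have h5 : (k.natAbs : ℝ) * δ⁻¹ ≤ 2 * Real.pi * k.natAbs * δ⁻¹ := by
        have : 0 ≤ (k.natAbs : ℝ) * δ⁻¹ := by positivity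
        nlinarith
      nlinarith [mul_nonneg (sub_nonneg.mpr hk1) hy]
    have h2 : ((k.natAbs : ℝ) * q) ^ 2 ≤ (y + 2 * Real.pi * k / δ) ^ 2 := by
      rw [← sq_abs (y + _)]; exact pow_le_pow_left₀ (by positivity) h1 2
    have h3 : (k.natAbs : ℝ) * Real.log r⁻¹ ≤ (y + 2 * Real.pi * k / δ) ^ 2 / 2 := by
      have : (k.natAbs : ℝ) * Real.log r⁻¹ ≤ (k.natAbs : ℝ) ^ 2 * Real.log r⁻¹ := by
        gcongr; nlinarith
      rw [mul_pow, hqsq] at h2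
      linarith
    calc Real.exp (-((y + 2 * Real.pi * k / δ) ^ 2 / 2))
        ≤ Real.exp (k.natAbs * Real.log r) := by
          apply Real.exp_le_exp.mpr; rw [Real.log_inv] at h3; linarith
      _ = r ^ k.natAbs := by rw [← Real.log_pow, Real.exp_log (by positivity)]
  have hgeo := hasSum_pow_natAbs hr.le (by linarith)
  have hsum : Summable fun k : ℤ => Real.exp (-((y + 2 * Real.pi * k / δ) ^ 2 / 2)) := by
    refine Summable.of_norm_bounded_eventually hgeo.summable ?_
    refine (Set.finite_singleton (0 : ℤ)).subset fun k hk => ?_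
    by_contra h0
    refine hk ?_
    change ‖Real.exp _‖ ≤ _
    rw [Real.norm_of_nonneg (Real.exp_pos _).le]
    exact hterm k h0
  have hs1 := hsum.tsum_eq_add_tsum_ite 0
  have hs2 := hgeo.summable.tsum_eq_add_tsum_ite 0
  have hle : (∑' k : ℤ, if k = 0 then 0 else Real.exp (-((y + 2 * Real.pi * k / δ) ^ 2 / 2))) ≤
      ∑' k : ℤ, if k = 0 then 0 else r ^ k.natAbs := by
    refine Summable.tsum_le_tsum (fun k => ?_) ?_ ?_
    · split_ifs with h
      · rfl
      · exact hterm k h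
    · refine hsum.of_nonneg_of_le (fun k => ?_) (fun k => ?_) <;> split_ifs <;>
        first | positivity | rfl
    · refine hgeo.summable.of_nonneg_of_le (fun k => ?_) (fun k => ?_) <;> split_ifs <;>
        first | positivity | rfl
  have h0 : (0 : ℝ) ≤ ∑' k : ℤ, if k = 0 then 0 else
      Real.exp (-((y + 2 * Real.pi * k / δ) ^ 2 / 2)) :=
    tsum_nonneg fun k => by split_ifs <;> positivity
  rw [hgeo.tsum_eq] at hs2
  have hinv : (1 - r)⁻¹ ≤ 5 / 4 := by
    rw [inv_le_comm₀ (by linarith) (by norm_num)]; linarith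
  have hinv' : (1 - r)⁻¹ = 1 + r * (1 - r)⁻¹ := by
    have : (1 - r) ≠ 0 := by linarith
    field_simp; ring
  simp only [Int.cast_zero, mul_zero, zero_div, add_zero, Int.natAbs_zero, pow_zero] at hs1 hs2
  rw [hs1, add_sub_cancel_left, abs_of_nonneg h0]
  have : r * (1 - r)⁻¹ ≤ r * (5 / 4) := by gcongr
  linarith

/-- The truncation error of the discretized Gaussian. -/
theorem tsum_gaussWeight_compl_le {δ : ℝ} (hδ : 0 < δ) (M : ℕ) :
    ∑' j : {j : ℤ // j ∉ Finset.Icc (-(M : ℤ)) (M : ℤ)}, gaussWeight δ j ≤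
      Real.exp (-((M : ℝ) ^ 2 * δ ^ 2 / 2)) * ∑' j, gaussWeight δ j := by
  rw [← tsum_mul_left]
  have hs := summable_gaussWeight hδ
  -- Each tail index is moved towards the origin by `M`. Positive indices stay positive and negative
  -- ones negative, so the map is injective, and `j² ≥ M² + (|j| - M)²` splits off the factor `exp
  -- (-M² δ² / 2)`.
  refine Summable.tsum_le_tsum_of_inj
    (fun j => if 0 < (j : ℤ) then (j : ℤ) - M else (j : ℤ) + M) ?_ ?_ ?_ (hs.subtype _)
    (hs.mul_left _)
  · rintro ⟨i, hi⟩ ⟨j, hj⟩ h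
    simp only [Finset.mem_Icc, not_and_or, not_le] at hi hj
    simp only at h
    rw [Subtype.mk.injEq]
    split_ifs at h <;> omega
  · intro j _
    exact mul_nonneg (Real.exp_pos _).le (gaussWeight_pos hδ j).le
  · rintro ⟨j, hj⟩
    simp only [Finset.mem_Icc, not_and_or, not_le] at hj
    have key : ∀ e : ℤ, (M : ℤ) ^ 2 + e ^ 2 ≤ j ^ 2 → gaussWeight δ j ≤
        Real.exp (-((M : ℝ) ^ 2 * δ ^ 2 / 2)) * gaussWeight δ e := by
      intro e he
      have he' : (M : ℝ) ^ 2 + (e : ℝ) ^ 2 ≤ (j : ℝ) ^ 2 := by exact_mod_cast he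
      rw [gaussWeight, gaussWeight, mul_left_comm, ← Real.exp_add]
      gcongr
      nlinarith [mul_le_mul_of_nonneg_right he' (sq_nonneg δ)]
    apply key
    have hM : (0 : ℤ) ≤ M := by positivity
    dsimp only
    split_ifs with h
    · have : (M : ℤ) ≤ j := by omega
      nlinarith
    · have : (M : ℤ) ≤ -j := by omega
      nlinarith

/-- At `y = 0` the modes are the weights, and the aliasing error `5r/2 ≤ 1/2` is added to the
Gaussian value `1`. -/
theorem sum_gaussWeight_le {δ r : ℝ} (hδ : 0 < δ) (hr : 0 < r) (hr1 : r ≤ 1 / 5)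
    (hrδ : Real.sqrt (2 * Real.log r⁻¹) ≤ δ⁻¹) :
    ∑' j, gaussWeight δ j ≤ 3 / 2 := by
  have h := abs_tsum_exp_sub_le hδ hr hr1 le_rfl (by rwa [zero_add])
  have h2 := tsum_gaussMode hδ 0
  have h3 : ∑' j, gaussMode δ 0 j = ((∑' j, gaussWeight δ j : ℝ) : ℂ) := by
    rw [Complex.ofReal_tsum]
    congr 1; ext j; simp [gaussMode]
  rw [h3, Complex.ofReal_inj] at h2
  rw [← h2] at h
  have := (abs_le.mp h).2
  norm_num at this
  linarith

/-- Error budget: aliasing with `r = γ/5` costs `γ/2`, truncation costs `γ/4` times the total weight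
`3/2`; together `7γ/8`. -/
theorem norm_sum_gaussMode_sub_le {δ y γ : ℝ} (hδ : 0 < δ) (hγ : γ ∈ Set.Ioo (0 : ℝ) 1)
    (hy : 0 ≤ y) (hyδ : y + Real.sqrt (2 * Real.log (5 / γ)) ≤ δ⁻¹) (M : ℕ)
    (hM : Real.exp (-((M : ℝ) ^ 2 * δ ^ 2 / 2)) ≤ γ / 4) :
    ‖(∑ j ∈ Finset.Icc (-(M : ℤ)) (M : ℤ), gaussMode δ y j) - (Real.exp (-(y ^ 2 / 2)) : ℂ)‖
      ≤ γ := by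
  have hr : (γ / 5)⁻¹ = 5 / γ := inv_div _ _
  have hγ0 := hγ.1
  have hγ1 := hγ.2
  rw [← hr] at hyδ
  have h1 := abs_tsum_exp_sub_le hδ (by positivity) (by linarith) hy hyδ
  have h2 := sum_gaussWeight_le hδ (r := γ / 5) (by positivity) (by linarith) (by linarith)
  have h3 := tsum_gaussWeight_compl_le hδ M
  have h4 := (summable_gaussMode hδ y).sum_add_tsum_subtype_compl
    (Finset.Icc (-(M : ℤ)) (M : ℤ))
  have h5 : ‖∑' j : {j : ℤ // j ∉ Finset.Icc (-(M : ℤ)) (M : ℤ)}, gaussMode δ y j‖ ≤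
      γ / 4 * (3 / 2) := by
    refine (norm_tsum_le_tsum_norm ?_).trans ?_
    · exact ((summable_gaussMode hδ y).norm).subtype _
    · simp_rw [norm_gaussMode hδ]
      refine h3.trans ?_
      have : 0 ≤ ∑' j, gaussWeight δ j := tsum_nonneg fun j => (gaussWeight_pos hδ j).le
      gcongr
  rw [tsum_gaussMode hδ] at h4
  rw [← eq_sub_iff_add_eq] at h4
  rw [h4, sub_right_comm, ← Complex.ofReal_sub]
  refine (norm_sub_le _ _).trans ?_
  rw [Complex.norm_real, Real.norm_eq_abs]
  linarith

/-! ### Functions of a Hermitian matrix -/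

section SpecFun

variable {d : Type} [Fintype d] [DecidableEq d] {A : Matrix d d ℂ}

/-- The matrix `f(A)`, defined in an eigenbasis of `A`. -/
def specFun (hA : A.IsHermitian) (f : ℝ → ℂ) : Matrix d d ℂ :=
  (hA.eigenvectorUnitary : Matrix d d ℂ) * diagonal (fun i => f (hA.eigenvalues i)) *
    (hA.eigenvectorUnitary : Matrix d d ℂ)ᴴ

theorem eigenvectorUnitary_conjTranspose_mul (hA : A.IsHermitian) :
    (hA.eigenvectorUnitary : Matrix d d ℂ)ᴴ * (hA.eigenvectorUnitary : Matrix d d ℂ) = 1 :=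
  Matrix.mem_unitaryGroup_iff'.mp hA.eigenvectorUnitary.2

theorem eigenvectorUnitary_mul_conjTranspose (hA : A.IsHermitian) :
    (hA.eigenvectorUnitary : Matrix d d ℂ) * (hA.eigenvectorUnitary : Matrix d d ℂ)ᴴ = 1 :=
  Matrix.mem_unitaryGroup_iff.mp hA.eigenvectorUnitary.2

theorem specFun_id (hA : A.IsHermitian) : specFun hA (fun x => (x : ℂ)) = A := by
  conv_rhs => rw [hA.spectral_theorem, Unitary.conjStarAlgAut_apply]
  rfl

theorem specFun_mul (hA : A.IsHermitian) (f g : ℝ → ℂ) :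
    specFun hA f * specFun hA g = specFun hA (fun x => f x * g x) := by
  simp only [specFun]
  calc _ = (hA.eigenvectorUnitary : Matrix d d ℂ) * diagonal (fun i => f (hA.eigenvalues i)) *
        ((hA.eigenvectorUnitary : Matrix d d ℂ)ᴴ * (hA.eigenvectorUnitary : Matrix d d ℂ)) *
        diagonal (fun i => g (hA.eigenvalues i)) *
        (hA.eigenvectorUnitary : Matrix d d ℂ)ᴴ := by simp only [Matrix.mul_assoc]
    _ = _ := by
      rw [eigenvectorUnitary_conjTranspose_mul, Matrix.mul_one,
        Matrix.mul_assoc (hA.eigenvectorUnitary : Matrix d d ℂ), diagonal_mul_diagonal]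

theorem specFun_smul (hA : A.IsHermitian) (c : ℂ) (f : ℝ → ℂ) :
    c • specFun hA f = specFun hA (fun x => c * f x) := by
  have : diagonal (fun i => c * f (hA.eigenvalues i)) =
      c • diagonal (fun i => f (hA.eigenvalues i)) := by rw [← diagonal_smul]; rfl
  simp only [specFun]
  rw [this, Matrix.mul_smul, Matrix.smul_mul]

theorem specFun_sub (hA : A.IsHermitian) (f g : ℝ → ℂ) :
    specFun hA f - specFun hA g = specFun hA (fun x => f x - g x) := by
  simp only [specFun]
  rw [← Matrix.sub_mul, ← Matrix.mul_sub, diagonal_sub]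

theorem specFun_sum {ι : Type} (hA : A.IsHermitian) (s : Finset ι) (f : ι → ℝ → ℂ) :
    ∑ j ∈ s, specFun hA (f j) = specFun hA (fun x => ∑ j ∈ s, f j x) := by
  classical
  simp only [specFun]
  rw [← Finset.sum_mul, ← Finset.mul_sum]
  congr 2
  ext a b
  rw [Matrix.sum_apply]
  by_cases h : a = b
  · subst h; simp
  · simp [h]

theorem specFun_conjTranspose (hA : A.IsHermitian) (f : ℝ → ℂ) :
    (specFun hA f)ᴴ = specFun hA (fun x => star (f x)) := by
  simp only [specFun, conjTranspose_mul, conjTranspose_conjTranspose, diagonal_conjTranspose,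
    Matrix.mul_assoc]
  rfl

theorem exp_specFun (hA : A.IsHermitian) (f : ℝ → ℂ) :
    NormedSpace.exp (specFun hA f) = specFun hA (fun x => Complex.exp (f x)) := by
  have hinv : (hA.eigenvectorUnitary : Matrix d d ℂ)⁻¹ =
      (hA.eigenvectorUnitary : Matrix d d ℂ)ᴴ :=
    Matrix.inv_eq_right_inv (eigenvectorUnitary_mul_conjTranspose hA)
  have hu : IsUnit (hA.eigenvectorUnitary : Matrix d d ℂ) :=
    (Matrix.isUnit_iff_isUnit_det _).mpr
      (Matrix.isUnit_det_of_right_inverse (eigenvectorUnitary_mul_conjTranspose hA))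
  have h := Matrix.exp_conj (hA.eigenvectorUnitary : Matrix d d ℂ)
    (diagonal fun i => f (hA.eigenvalues i)) hu
  rw [hinv, Matrix.exp_diagonal] at h
  rw [specFun, h, specFun]
  congr 3
  ext i
  rw [Pi.coe_exp, Complex.exp_eq_exp_ℂ]

theorem norm_specFun_le (hA : A.IsHermitian) (f : ℝ → ℂ) {B : ℝ} (hB : 0 ≤ B)
    (hf : ∀ x ∈ spectrum ℝ A, ‖f x‖ ≤ B) : ‖specFun hA f‖ ≤ B := by
  have h : ‖specFun hA f‖ = ‖(diagonal fun i => f (hA.eigenvalues i) : Matrix d d ℂ)‖ := by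
    have h1 := CStarRing.norm_mul_coe_unitary
      ((hA.eigenvectorUnitary : Matrix d d ℂ) * diagonal (fun i => f (hA.eigenvalues i)))
      (star hA.eigenvectorUnitary)
    have h2 := CStarRing.norm_coe_unitary_mul hA.eigenvectorUnitary
      (diagonal (fun i => f (hA.eigenvalues i)) : Matrix d d ℂ)
    rw [← h2, ← h1]
    rfl
  rw [h, Matrix.l2_opNorm_diagonal]
  exact (pi_norm_le_iff_of_nonneg hB).mpr fun i => hf _ (hA.eigenvalues_mem_spectrum_real i)

/-- In the eigenbasis, the coordinates of `v` vanish at every index whose eigenvalue differs from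
`x`, so degeneracy does no harm. -/
theorem specFun_mulVec (hA : A.IsHermitian) (f : ℝ → ℂ) {v : d → ℂ} {x : ℝ}
    (hv : A *ᵥ v = (x : ℂ) • v) : specFun hA f *ᵥ v = f x • v := by
  set U := (hA.eigenvectorUnitary : Matrix d d ℂ) with hU
  have hUU : Uᴴ * U = 1 := eigenvectorUnitary_conjTranspose_mul hA
  have hUU' : U * Uᴴ = 1 := eigenvectorUnitary_mul_conjTranspose hA
  have h1 : diagonal (fun i => (hA.eigenvalues i : ℂ)) *ᵥ (Uᴴ *ᵥ v) = (x : ℂ) • (Uᴴ *ᵥ v) := by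
    rw [← specFun_id hA, specFun, ← hU] at hv
    have := congrArg (fun w => Uᴴ *ᵥ w) hv
    simp only [mulVec_mulVec, mulVec_smul] at this
    rwa [← Matrix.mul_assoc, ← Matrix.mul_assoc, hUU, Matrix.one_mul, ← mulVec_mulVec] at this
  have h2 : diagonal (fun i => f (hA.eigenvalues i)) *ᵥ (Uᴴ *ᵥ v) = f x • (Uᴴ *ᵥ v) := by
    ext i
    have h3 := congrFun h1 i
    simp only [mulVec_diagonal, Pi.smul_apply, smul_eq_mul] at h3 ⊢
    by_cases h0 : (Uᴴ *ᵥ v) i = 0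
    · rw [h0, mul_zero, mul_zero]
    · have := Complex.ofReal_injective (mul_right_cancel₀ h0 h3)
      rw [this]
  rw [specFun, ← hU, ← mulVec_mulVec, ← mulVec_mulVec, h2, mulVec_smul, mulVec_mulVec, hUU',
    one_mulVec]

/-- The indicator of `{x}` gives the spectral projection at `x`, which vanishes when `x` is not an
eigenvalue. -/
theorem mulVec_specFun_ite (hA : A.IsHermitian) (x : ℝ) (w : d → ℂ) :
    A *ᵥ (specFun hA (fun y => if y = x then 1 else 0) *ᵥ w) =
      (x : ℂ) • (specFun hA (fun y => if y = x then 1 else 0) *ᵥ w) := by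
  nth_rewrite 1 [← specFun_id hA]
  rw [mulVec_mulVec, specFun_mul, ← smul_mulVec, specFun_smul]
  congr 2
  ext y
  split_ifs with h
  · rw [h]
  · simp

theorem evolution_eq_specFun (hA : A.IsHermitian) (s : ℝ) :
    evolution A s = specFun hA (fun x => Complex.exp (-(Complex.I * ((s * x : ℝ) : ℂ)))) := by
  conv_lhs => rw [evolution, ← specFun_id hA, specFun_smul, exp_specFun]
  congr 1; ext x; push_cast; ring_nf

theorem exp_neg_smul_sq_eq_specFun (hA : A.IsHermitian) (t : ℝ) :
    NormedSpace.exp ((-(t : ℂ)) • A ^ 2) =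
      specFun hA (fun x => ((Real.exp (-(t * x ^ 2)) : ℝ) : ℂ)) := by
  conv_lhs => rw [← specFun_id hA, pow_two, specFun_mul, specFun_smul, exp_specFun]
  congr 1; ext x; push_cast; ring_nf

theorem op_eq_specFun {ι : Type} [Fintype ι] (L : EvolutionLCU ι) (hA : A.IsHermitian) :
    L.op A = specFun hA (fun x => ∑ j, (L.coeff j : ℂ) *
      Complex.exp (-(Complex.I * ((L.time j * x : ℝ) : ℂ)))) := by
  rw [EvolutionLCU.op, ← specFun_sum]
  refine Finset.sum_congr rfl fun j _ => ?_
  rw [evolution_eq_specFun hA, specFun_smul]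

end SpecFun

/-! ### Perturbation of expectation values -/

section Perturbation

variable {E : Type*} [NormedAddCommGroup E] [InnerProductSpace ℂ E]

/-- A difference of squares: the cross terms have equal real parts by symmetry and cancel. -/
theorem re_inner_sub_re_inner_of_symmetric {O : E →L[ℂ] E} (hO : O.IsSymmetric) (x y : E) :
    (inner ℂ x (O x)).re - (inner ℂ y (O y)).re = (inner ℂ (x - y) (O (x + y))).re := by
  have h : (inner ℂ x (O y)).re = (inner ℂ y (O x)).re := by
    have h1 : inner ℂ (O x) y = inner ℂ x (O y) := hO x y
    rw [← h1, ← inner_conj_symm, Complex.conj_re]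
  rw [map_add, inner_sub_left, inner_add_right, inner_add_right]
  simp only [Complex.sub_re, Complex.add_re]
  linarith

theorem abs_re_inner_sub_le {O : E →L[ℂ] E} (hO : O.IsSymmetric) (x y : E) :
    |(inner ℂ x (O x)).re - (inner ℂ y (O y)).re| ≤ ‖O‖ * (‖x - y‖ * ‖x + y‖) := by
  rw [re_inner_sub_re_inner_of_symmetric hO]
  refine (Complex.abs_re_le_norm _).trans ((norm_inner_le_norm _ _).trans ?_)
  have := O.le_opNorm (x + y)
  nlinarith [norm_nonneg (x - y), mul_le_mul_of_nonneg_left this (norm_nonneg (x - y))]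

/-- The expectation value in a vector close to the line of `v`. -/
theorem abs_re_inner_sub_norm_sq_mul_le {O : E →L[ℂ] E} (hO : O.IsSymmetric) {v R : E} {β : ℂ}
    (hv : ‖v‖ = 1) (hR : inner ℂ v R = 0) (hβ : β ≠ 0) :
    |(inner ℂ (β • v + R) (O (β • v + R))).re - ‖β • v + R‖ ^ 2 * (inner ℂ v (O v)).re| ≤
      2 * ‖O‖ * (‖β • v + R‖ * ‖R‖) := by
  set n := ‖β • v + R‖ with hn
  have hβ0 : 0 < ‖β‖ := norm_pos_iff.mpr hβ
  -- The comparison vector is `n u v`: it has the norm of `β v + R` and the phase of `β`, and its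
  -- expectation value is exactly `n² ⟨v, O v⟩`.
  set u : ℂ := β / ‖β‖ with hu
  have hβu : β = (‖β‖ : ℂ) * u := by
    rw [hu]; field_simp
  have hu1 : ‖u‖ = 1 := by
    rw [hu, norm_div, Complex.norm_real, norm_norm, div_self hβ0.ne']
  have hpyth : ∀ a : ℂ, ‖a • v + R‖ ^ 2 = ‖a‖ ^ 2 + ‖R‖ ^ 2 := by
    intro a
    have h := norm_add_sq_eq_norm_sq_add_norm_sq_of_inner_eq_zero (a • v) R
      (by rw [inner_smul_left, hR, mul_zero])
    rw [norm_smul, hv, mul_one] at h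
    rw [sq, sq, sq, h]
  have hz : (inner ℂ (((n : ℂ) * u) • v) (O (((n : ℂ) * u) • v))).re =
      n ^ 2 * (inner ℂ v (O v)).re := by
    rw [map_smul, inner_smul_left, inner_smul_right, ← mul_assoc, ← Complex.normSq_eq_conj_mul_self,
      Complex.re_ofReal_mul, Complex.normSq_eq_norm_sq, norm_mul, hu1, mul_one, Complex.norm_real,
      Real.norm_eq_abs, sq_abs]
  have h := abs_re_inner_sub_le hO (β • v + R) (((n : ℂ) * u) • v)
  rw [hz] at h
  refine h.trans ?_
  have h1 : β • v + R - ((n : ℂ) * u) • v = (((‖β‖ - n : ℝ) : ℂ) * u) • v + R := by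
    nth_rewrite 1 [hβu]; push_cast; module
  have h2 : β • v + R + ((n : ℂ) * u) • v = (((‖β‖ + n : ℝ) : ℂ) * u) • v + R := by
    nth_rewrite 1 [hβu]; push_cast; module
  have hn2 : n ^ 2 = ‖β‖ ^ 2 + ‖R‖ ^ 2 := hpyth β
  have hn0 : 0 ≤ n := norm_nonneg _
  -- With `‖R‖² = n² - ‖β‖²` the squared norms of difference and sum are `2n(n - ‖β‖)` and `2n(n +
  -- ‖β‖)`, whose product is `4 n² ‖R‖²`. The bound is thus an equality.
  have h3 : ‖β • v + R - ((n : ℂ) * u) • v‖ * ‖β • v + R + ((n : ℂ) * u) • v‖ ≤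
      2 * (n * ‖R‖) := by
    refine le_of_sq_le_sq ?_ (by positivity)
    rw [mul_pow, h1, h2, hpyth, hpyth, norm_mul, norm_mul, hu1, mul_one, mul_one,
      Complex.norm_real, Complex.norm_real, Real.norm_eq_abs, Real.norm_eq_abs, sq_abs, sq_abs]
    have hR2 : ‖R‖ ^ 2 = n ^ 2 - ‖β‖ ^ 2 := by linarith
    rw [mul_pow, mul_pow, hR2]
    apply le_of_eq; ring
  calc ‖O‖ * _ ≤ ‖O‖ * (2 * (n * ‖R‖)) := by gcongr
    _ = _ := by ring

/-- Scalar error budget, after multiplying by `l ≥ p - 0.08 w`: the numerator errors sum to `0.708 ε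
p + 0.16 ε w`, and this is at most `ε l` because `0.24 w ≤ 0.292 p` when `p ≥ 0.9 w`. -/
theorem abs_div_sub_le {μ l m p f ε r w B : ℝ} (hε : 0 < ε) (hr1 : r ≤ 1) (hrB : B * r = ε)
    (hw : 0 < w) (hp : 9 / 10 * w ≤ p) (hm : |m| ≤ B) (hf : |f - p * m| ≤ 708 / 1000 * (ε * p))
    (hμ : |μ - f| ≤ 8 / 100 * (ε * w)) (hl : |l - p| ≤ 8 / 100 * (r * w)) :
    l ≠ 0 ∧ |μ / l - m| ≤ ε := by
  have hl0 : p - 8 / 100 * (r * w) ≤ l := by linarith [(abs_le.mp hl).1]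
  have hrw : r * w ≤ w := mul_le_of_le_one_left hw.le hr1
  have hlpos : 0 < l := by linarith
  refine ⟨hlpos.ne', ?_⟩
  have e2 : |(p - l) * m| ≤ 8 / 100 * (ε * w) := by
    rw [abs_mul, abs_sub_comm]
    calc _ ≤ 8 / 100 * (r * w) * B :=
          mul_le_mul hl hm (abs_nonneg _) ((abs_nonneg _).trans hl)
      _ = _ := by rw [← hrB]; ring
  have e3 : |μ - l * m| ≤ |μ - f| + |f - p * m| + |(p - l) * m| := by
    rw [show μ - l * m = (μ - f) + (f - p * m) + (p - l) * m by ring]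
    exact abs_add_three _ _ _
  have e4 : ε * (p - 8 / 100 * w) ≤ ε * l := mul_le_mul_of_nonneg_left (by linarith) hε.le
  have e5 : ε * (9 / 10 * w) ≤ ε * p := mul_le_mul_of_nonneg_left hp hε.le
  have hεw : 0 < ε * w := by positivity
  rw [show μ / l - m = (μ - l * m) / l by field_simp, abs_div, abs_of_pos hlpos,
    div_le_iff₀ hlpos]
  linarith

/-- A quotient of estimates of `⟨x, O x⟩` and `‖x‖²` is close to `⟨v, O v⟩` if `x` is close to a
vector close to the line of `v`. -/
theorem abs_div_sub_re_inner_le {O : E →L[ℂ] E} (hO : O.IsSymmetric) {v R x : E} {β : ℂ}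
    {ε η μ l : ℝ} (hv : ‖v‖ = 1) (hR : inner ℂ v R = 0) (hε : 0 < ε) (hε1 : ε < 1)
    (hεO : ε ≤ ‖O‖) (hη : 0 < η) (hη1 : η ≤ 1) (hRβ : 8 * ‖O‖ ^ 2 * ‖R‖ ^ 2 ≤ ε ^ 2 * ‖β‖ ^ 2)
    (hβ : 9 / 10 * η ^ 2 ≤ ‖β‖ ^ 2) (hφ : ‖β • v + R‖ ≤ 1)
    (hx : ‖x - (β • v + R)‖ ≤ ε * η ^ 2 / (30 * ‖O‖))
    (hμ : |μ - (inner ℂ x (O x)).re| ≤ ε * η ^ 2 / 100)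
    (hl : |l - ‖x‖ ^ 2| ≤ ε * η ^ 2 / (100 * ‖O‖)) :
    l ≠ 0 ∧ |μ / l - (inner ℂ v (O v)).re| ≤ ε := by
  have hO0 : 0 < ‖O‖ := hε.trans_le hεO
  have hβ0 : β ≠ 0 := by
    rintro rfl
    rw [norm_zero] at hβ
    nlinarith [sq_pos_of_pos hη]
  have h1 := abs_re_inner_sub_norm_sq_mul_le hO hv hR hβ0
  set φ := β • v + R with hφdef
  set p := ‖φ‖ ^ 2 with hp
  set m := (inner ℂ v (O v)).re with hm
  set a := (inner ℂ x (O x)).re with ha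
  set f := (inner ℂ φ (O φ)).re with hf
  have hpβ : ‖β‖ ^ 2 + ‖R‖ ^ 2 = p := by
    have h := norm_add_sq_eq_norm_sq_add_norm_sq_of_inner_eq_zero (β • v) R
      (by rw [inner_smul_left, hR, mul_zero])
    rw [norm_smul, hv, mul_one] at h
    rw [hp, sq, sq, sq, ← h]
  have hpβ' : ‖β‖ ^ 2 ≤ p := by nlinarith [sq_nonneg ‖R‖]
  have hm1 : |m| ≤ ‖O‖ := by
    refine (Complex.abs_re_le_norm _).trans ((norm_inner_le_norm _ _).trans ?_)
    have := O.le_opNorm v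
    rw [hv] at this ⊢
    linarith
  have hp0 : 0 ≤ p := sq_nonneg _
  -- Squaring gives the true constant `1/√2`; `0.708` is a rational number just above it.
  have h2 : 2 * ‖O‖ * (‖φ‖ * ‖R‖) ≤ 708 / 1000 * (ε * p) := by
    refine le_of_sq_le_sq ?_ (by positivity)
    have e1 : (2 * ‖O‖ * (‖φ‖ * ‖R‖)) ^ 2 = 1 / 2 * (p * (8 * ‖O‖ ^ 2 * ‖R‖ ^ 2)) := by
      rw [hp]; ring
    have e2 : p * (8 * ‖O‖ ^ 2 * ‖R‖ ^ 2) ≤ p * (ε ^ 2 * p) := by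
      refine mul_le_mul_of_nonneg_left (hRβ.trans ?_) hp0
      gcongr
    have e3 : 0 ≤ (ε * p) ^ 2 := sq_nonneg _
    rw [e1]
    linear_combination 1 / 2 * e2 + (708 ^ 2 / 1000 ^ 2 - 1 / 2) * e3
  set r := ε / ‖O‖ with hr
  have hr1 : r ≤ 1 := (div_le_one hO0).mpr hεO
  have hr0 : 0 < r := by positivity
  have hrO : ‖O‖ * r = ε := by rw [hr]; field_simp
  have hη2 : η ^ 2 ≤ 1 := by nlinarith
  have hη20 : 0 < η ^ 2 := by positivity
  have hx' : ‖x - φ‖ ≤ r * η ^ 2 / 30 := by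
    refine hx.trans_eq ?_
    rw [hr]; field_simp
  have hl' : |l - ‖x‖ ^ 2| ≤ r * η ^ 2 / 100 := by
    refine hl.trans_eq ?_
    rw [hr]; field_simp
  -- Here `‖x + φ‖ ≤ 2 + 1/30 ≤ 21/10`, and `21/10 · 1/30 = 7/100`. The sampling error `1/100` later
  -- raises this to `8/100`.
  have hxp : ‖x - φ‖ * ‖x + φ‖ ≤ 7 / 100 * (r * η ^ 2) := by
    have e1 : ‖x + φ‖ ≤ ‖x - φ‖ + 2 * ‖φ‖ := by
      have := norm_add_le (x - φ) ((2 : ℂ) • φ)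
      rw [norm_smul, Complex.norm_ofNat] at this
      rwa [show x - φ + (2 : ℂ) • φ = x + φ by module] at this
    have e2 : r * η ^ 2 ≤ 1 := mul_le_one₀ hr1 hη20.le hη2
    have e3 : ‖x + φ‖ ≤ 21 / 10 := by linarith
    calc _ ≤ r * η ^ 2 / 30 * (21 / 10) := by gcongr
      _ = _ := by ring
  have hfa : |a - f| ≤ ‖O‖ * (7 / 100 * (r * η ^ 2)) :=
    (abs_re_inner_sub_le hO x φ).trans (by gcongr)
  have hxa : |‖x‖ ^ 2 - p| ≤ 7 / 100 * (r * η ^ 2) := by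
    have e1 : |‖x‖ - ‖φ‖| ≤ ‖x - φ‖ := abs_norm_sub_norm_le x φ
    have e2 : |‖x‖ ^ 2 - p| = |‖x‖ - ‖φ‖| * (‖x‖ + ‖φ‖) := by
      rw [hp, sq_sub_sq, abs_mul, mul_comm, abs_of_nonneg (by positivity : 0 ≤ ‖x‖ + ‖φ‖)]
    have e3 : ‖x‖ ≤ ‖x - φ‖ + ‖φ‖ := norm_le_norm_sub_add x φ
    have e4 : r * η ^ 2 ≤ 1 := mul_le_one₀ hr1 hη20.le hη2
    have e5 : ‖x‖ + ‖φ‖ ≤ 21 / 10 := by linarith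
    rw [e2]
    calc _ ≤ r * η ^ 2 / 30 * (21 / 10) := by gcongr; exact e1.trans hx'
      _ = _ := by ring
  have hlp : |l - p| ≤ 8 / 100 * (r * η ^ 2) := by
    have := abs_add_le (l - ‖x‖ ^ 2) (‖x‖ ^ 2 - p)
    rw [sub_add_sub_cancel] at this
    linarith
  have hμf : |μ - f| ≤ 8 / 100 * (ε * η ^ 2) := by
    have := abs_add_le (μ - a) (a - f)
    rw [sub_add_sub_cancel] at this
    have e : ‖O‖ * (7 / 100 * (r * η ^ 2)) = 7 / 100 * (ε * η ^ 2) := by rw [← hrO]; ring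
    linarith
  refine abs_div_sub_le hε hr1 hrO hη20 ?_ hm1 (h1.trans h2) hμf hlp
  exact hβ.trans hpβ'

end Perturbation

/-! ### The law of one run -/

open MeasureTheory

theorem ae_of_forall_mem_support {p : PMF ℝ} {q : ℝ → Prop} (hq : MeasurableSet {x | q x})
    (h : ∀ x ∈ p.support, q x) : ∀ᵐ x ∂p.toMeasure, q x := by
  rw [ae_iff]
  change p.toMeasure {x | q x}ᶜ = 0
  rw [PMF.toMeasure_apply_eq_zero_iff _ hq.compl, Set.disjoint_compl_right_iff_subset]
  exact h

theorem integrable_id_of_support_bounded {p : PMF ℝ} {B : ℝ} (h : ∀ x ∈ p.support, |x| ≤ B) :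
    Integrable (fun x => x) p.toMeasure :=
  Integrable.of_bound measurable_id.aestronglyMeasurable B
    (ae_of_forall_mem_support (measurableSet_le (by fun_prop) measurable_const) h)

theorem toMeasure_bind_eq_sum {α : Type*} [Fintype α] (p : PMF α) (f : α → PMF ℝ) :
    (p.bind f).toMeasure = ∑ a, p a • (f a).toMeasure := by
  let _ : MeasurableSpace α := ⊤
  ext s hs
  rw [PMF.toMeasure_bind_apply _ _ _ hs, tsum_fintype]
  simp

theorem integral_toMeasure_bind {α : Type*} [Fintype α] (p : PMF α) (f : α → PMF ℝ) {B : ℝ}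
    (h : ∀ a, ∀ x ∈ (f a).support, |x| ≤ B) :
    ∫ x, x ∂(p.bind f).toMeasure = ∑ a, (p a).toReal * ∫ x, x ∂(f a).toMeasure := by
  rw [toMeasure_bind_eq_sum, integral_finsetSum_measure fun a _ =>
    (integrable_id_of_support_bounded (h a)).smul_measure (p.apply_ne_top a)]
  simp [integral_smul_measure]

section Born

variable {n : Type} [Fintype n] [DecidableEq n]

theorem QState.mem_support_measure (ρ : QState n) {A : Matrix n n ℂ} (hA : A.IsHermitian) {x : ℝ}
    (hx : x ∈ (ρ.measure hA).support) : ∃ i, hA.eigenvalues i = x := by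
  rw [QState.measure, PMF.mem_support_map_iff] at hx
  obtain ⟨i, _, h⟩ := hx
  exact ⟨i, h⟩

/-- The Born rule for expectation values. -/
theorem QState.integral_measure (ρ : QState n) {A : Matrix n n ℂ} (hA : A.IsHermitian) :
    ∫ x, x ∂(ρ.measure hA).toMeasure = (ρ.mat * A).trace.re := by
  have hb : ∀ i, ∀ x ∈ (PMF.pure (hA.eigenvalues i)).support,
      |x| ≤ ∑ j, |hA.eigenvalues j| := by
    intro i x hx
    rw [PMF.mem_support_pure_iff] at hx
    rw [hx]
    exact Finset.single_le_sum (f := fun j => |hA.eigenvalues j|) (fun j _ => abs_nonneg _)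
      (Finset.mem_univ i)
  -- `PMF.map` unfolds to a bind with `PMF.pure`, so the outcome law is a finite mixture of point
  -- masses.
  have h := integral_toMeasure_bind
    (PMF.ofFintype (fun i => ENNReal.ofReal (ρ.eigenProb hA i)) (by
      rw [← ENNReal.ofReal_sum_of_nonneg (fun i _ => ρ.eigenProb_nonneg hA i),
        ρ.sum_eigenProb hA, ENNReal.ofReal_one])) (fun i => PMF.pure (hA.eigenvalues i)) hb
  have hm : ∫ x, x ∂(ρ.measure hA).toMeasure = ∑ i, ρ.eigenProb hA i * hA.eigenvalues i := by
    refine h.trans (Finset.sum_congr rfl fun i _ => ?_)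
    rw [PMF.toMeasure_pure, integral_dirac, PMF.ofFintype_apply,
      ENNReal.toReal_ofReal (ρ.eigenProb_nonneg hA i)]
  have ht : (ρ.mat * A).trace = ∑ i, ((hA.eigenvectorUnitary : Matrix n n ℂ)ᴴ * ρ.mat *
      (hA.eigenvectorUnitary : Matrix n n ℂ)) i i * (hA.eigenvalues i : ℂ) := by
    conv_lhs => rw [← specFun_id hA, specFun, ← Matrix.mul_assoc, trace_mul_comm,
      ← Matrix.mul_assoc, ← Matrix.mul_assoc]
    simp [Matrix.trace, mul_diagonal]
  rw [hm, ht, Complex.re_sum]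
  refine Finset.sum_congr rfl fun i _ => ?_
  rw [QState.eigenProb, Complex.re_mul_ofReal]

end Born

theorem trace_mul_ofVec_mul {d : Type} [Fintype d] (X O : Matrix d d ℂ) (ψ : d → ℂ)
    (hψ : star ψ ⬝ᵥ ψ = 1) :
    (X * (QState.ofVec ψ hψ).mat * Xᴴ * O).trace = star (X *ᵥ ψ) ⬝ᵥ (O *ᵥ (X *ᵥ ψ)) := by
  rw [QState.ofVec, mul_vecMulVec, vecMulVec_mul, vecMulVec_mul, trace_vecMulVec, dotProduct_comm,
    ← star_mulVec, ← dotProduct_mulVec]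

section Run

variable {d : Type} [Fintype d] [DecidableEq d]

theorem norm_toLp_mulVec_le (A : Matrix d d ℂ) (v : d → ℂ) :
    ‖WithLp.toLp 2 (A *ᵥ v)‖ ≤ ‖A‖ * ‖WithLp.toLp 2 v‖ :=
  Matrix.l2_opNorm_mulVec A (WithLp.toLp 2 v)

/-- An eigenvector with halves `v₀`, `v₁` satisfies `O v₁ = x v₀` and `O v₀ = x v₁`. Adding the two
norm estimates gives the bound, since the halves do not both vanish. -/
theorem abs_eigenvalues_pauliX_kronecker_le {O : Matrix d d ℂ} (hO : O.IsHermitian)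
    (i : Fin 2 × d) : |(isHermitian_pauliX_kronecker hO).eigenvalues i| ≤ ‖O‖ := by
  set x := (isHermitian_pauliX_kronecker hO).eigenvalues i with hx
  have hv := (isHermitian_pauliX_kronecker hO).mulVec_eigenvectorBasis i
  have hne : (isHermitian_pauliX_kronecker hO).eigenvectorBasis i ≠ 0 :=
    (isHermitian_pauliX_kronecker hO).eigenvectorBasis.orthonormal.ne_zero i
  set v : Fin 2 × d → ℂ := ⇑((isHermitian_pauliX_kronecker hO).eigenvectorBasis i) with hvdef
  have h0 : O *ᵥ (fun k => v (1, k)) = (x : ℂ) • fun k => v (0, k) := by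
    ext k
    have := congrFun hv (0, k)
    simpa [mulVec, dotProduct, Fintype.sum_prod_type, pauliX, kroneckerMap_apply, hx, hvdef]
      using this
  have h1 : O *ᵥ (fun k => v (0, k)) = (x : ℂ) • fun k => v (1, k) := by
    ext k
    have := congrFun hv (1, k)
    simpa [mulVec, dotProduct, Fintype.sum_prod_type, pauliX, kroneckerMap_apply, hx, hvdef]
      using this
  have n0 := norm_toLp_mulVec_le O (fun k => v (1, k))
  have n1 := norm_toLp_mulVec_le O (fun k => v (0, k))
  rw [h0, WithLp.toLp_smul, norm_smul, Complex.norm_real, Real.norm_eq_abs] at n0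
  rw [h1, WithLp.toLp_smul, norm_smul, Complex.norm_real, Real.norm_eq_abs] at n1
  have hpos : 0 < ‖WithLp.toLp 2 (fun k => v (0, k))‖ + ‖WithLp.toLp 2 (fun k => v (1, k))‖ := by
    by_contra hneg
    have z0 : ‖WithLp.toLp 2 (fun k => v (0, k))‖ = 0 := by
      linarith [norm_nonneg (WithLp.toLp 2 (fun k => v (0, k))),
        norm_nonneg (WithLp.toLp 2 (fun k => v (1, k)))]
    have z1 : ‖WithLp.toLp 2 (fun k => v (1, k))‖ = 0 := by
      linarith [norm_nonneg (WithLp.toLp 2 (fun k => v (0, k))),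
        norm_nonneg (WithLp.toLp 2 (fun k => v (1, k)))]
    rw [norm_eq_zero, WithLp.toLp_eq_zero] at z0 z1
    refine hne ?_
    ext ⟨b, k⟩
    fin_cases b
    · exact congrFun z0 k
    · exact congrFun z1 k
  by_contra hlt
  rw [not_le] at hlt
  nlinarith

/-- Each gate is the identity on the ancilla sector of the other, so the product is block diagonal.
-/
theorem EvolutionLCU.circuit_mat {ι : Type} (L : EvolutionLCU ι) (H : Matrix d d ℂ) (j₁ j₂ : ι) :
    (CtrlEvolution.mat ⟨0, L.time j₂⟩ H) * (CtrlEvolution.mat ⟨1, L.time j₁⟩ H) =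
      Matrix.single (0 : Fin 2) 0 (1 : ℂ) ⊗ₖ evolution H (L.time j₂) +
        Matrix.single (1 : Fin 2) 1 (1 : ℂ) ⊗ₖ evolution H (L.time j₁) := by
  have h1 : (1 : Matrix (Fin 2) (Fin 2) ℂ) - Matrix.single 1 1 1 = Matrix.single 0 0 1 := by
    ext i j; fin_cases i <;> fin_cases j <;> simp [Matrix.single]
  have h0 : (1 : Matrix (Fin 2) (Fin 2) ℂ) - Matrix.single 0 0 1 = Matrix.single 1 1 1 := by
    ext i j; fin_cases i <;> fin_cases j <;> simp [Matrix.single]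
  simp only [CtrlEvolution.mat, h0, h1]
  rw [Matrix.mul_add, Matrix.add_mul, Matrix.add_mul]
  simp only [← mul_kronecker_mul]
  simp [Matrix.single_mul_single_of_ne, add_comm]

/-- Measuring `X` on the ancilla sees only the off-diagonal blocks; this leaves the interference
terms between the two evolutions in `EvolutionLCU.trace_circuit_apply`. -/
theorem trace_single_plus_pauliX (a b : Fin 2) :
    (Matrix.single a a (1 : ℂ) * plusState.mat * Matrix.single b b (1 : ℂ) * pauliX).trace =
      if a = b then 0 else 1 / 2 := by
  have h : ((Real.sqrt 2 : ℝ) : ℂ)⁻¹ * ((Real.sqrt 2 : ℝ) : ℂ)⁻¹ = 1 / 2 := by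
    rw [← mul_inv, ← Complex.ofReal_mul, Real.mul_self_sqrt (by norm_num)]; norm_num
  fin_cases a <;> fin_cases b <;>
    simp [Matrix.trace, Matrix.mul_apply, Fin.sum_univ_two, Matrix.single, pauliX, plusState,
      QState.ofVec, vecMulVec_apply, h]

theorem EvolutionLCU.trace_circuit_apply {ι : Type} (L : EvolutionLCU ι) {H : Matrix d d ℂ}
    (hH : H.IsHermitian) (ρ : QState d) (O : Matrix d d ℂ) (j₁ j₂ : ι) :
    (((L.circuit j₁ j₂).apply hH (plusState.tensor ρ)).mat * (pauliX ⊗ₖ O)).trace =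
      1 / 2 * ((evolution H (L.time j₂) * ρ.mat * (evolution H (L.time j₁))ᴴ * O).trace +
        (evolution H (L.time j₁) * ρ.mat * (evolution H (L.time j₂))ᴴ * O).trace) := by
  have h : ((L.circuit j₁ j₂).apply hH (plusState.tensor ρ)).mat =
      (CtrlEvolution.mat ⟨0, L.time j₂⟩ H * CtrlEvolution.mat ⟨1, L.time j₁⟩ H) *
        (plusState.mat ⊗ₖ ρ.mat) *
        (CtrlEvolution.mat ⟨0, L.time j₂⟩ H * CtrlEvolution.mat ⟨1, L.time j₁⟩ H)ᴴ := by
    rw [conjTranspose_mul]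
    simp only [Matrix.mul_assoc]
    simp [EvolutionLCU.circuit, Circuit.apply, QState.evolve, QState.tensor, Matrix.mul_assoc]
  rw [h, L.circuit_mat, conjTranspose_add, conjTranspose_kronecker, conjTranspose_kronecker,
    conjTranspose_single, conjTranspose_single, star_one]
  simp only [Matrix.add_mul, Matrix.mul_add, ← mul_kronecker_mul, trace_add, trace_kronecker,
    trace_single_plus_pauliX]
  simp
  ring

variable {ι : Type} [Fintype ι] [Nonempty ι]

theorem EvolutionLCU.abs_le_of_mem_support_run (L : EvolutionLCU ι) {H : Matrix d d ℂ}
    (hH : H.IsHermitian) (ρ : QState d) {O : Matrix d d ℂ} (hO : O.IsHermitian) {x : ℝ}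
    (hx : x ∈ (L.run hH ρ hO).support) : |x| ≤ ‖O‖ := by
  rw [EvolutionLCU.run, PMF.mem_support_bind_iff] at hx
  obtain ⟨j₁, _, hx⟩ := hx
  rw [PMF.mem_support_bind_iff] at hx
  obtain ⟨j₂, _, hx⟩ := hx
  obtain ⟨i, rfl⟩ := QState.mem_support_measure _ _ hx
  exact abs_eigenvalues_pauliX_kronecker_le hO i

/-- The two interference terms are exchanged by swapping `j₁` and `j₂`, and the weights `c_{j₁}
c_{j₂}` are symmetric. Averaging therefore gives the same double sum twice, namely the expansion of
`X ρ X† O`; the factor `‖c‖₁²` undoes the normalization of the sampling law. -/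
theorem EvolutionLCU.integral_run (L : EvolutionLCU ι) {H : Matrix d d ℂ}
    (hH : H.IsHermitian) (ρ : QState d) {O : Matrix d d ℂ} (hO : O.IsHermitian) :
    L.l1 ^ 2 * ∫ x, x ∂(L.run hH ρ hO).toMeasure = (L.op H * ρ.mat * (L.op H)ᴴ * O).trace.re := by
  have hb : ∀ j₁ j₂, ∀ x ∈ (((L.circuit j₁ j₂).apply hH (plusState.tensor ρ)).measure
      (isHermitian_pauliX_kronecker hO)).support, |x| ≤ ‖O‖ := by
    intro j₁ j₂ x hx
    obtain ⟨i, rfl⟩ := QState.mem_support_measure _ _ hx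
    exact abs_eigenvalues_pauliX_kronecker_le hO i
  have hs : ∀ j, (L.sample j).toReal = L.coeff j / L.l1 := fun j => by
    rw [EvolutionLCU.sample, PMF.ofFintype_apply,
      ENNReal.toReal_ofReal (div_nonneg (L.coeff_pos j).le L.l1_pos.le)]
  have h1 : ∫ x, x ∂(L.run hH ρ hO).toMeasure = ∑ j₁, ∑ j₂, L.coeff j₁ / L.l1 * (L.coeff j₂ / L.l1 *
      (1 / 2 * ((evolution H (L.time j₂) * ρ.mat * (evolution H (L.time j₁))ᴴ * O).trace +
        (evolution H (L.time j₁) * ρ.mat * (evolution H (L.time j₂))ᴴ * O).trace)).re) := by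
    rw [EvolutionLCU.run, integral_toMeasure_bind (B := ‖O‖)]
    · refine Finset.sum_congr rfl fun j₁ _ => ?_
      rw [integral_toMeasure_bind (B := ‖O‖) _ _ (hb j₁), hs, Finset.mul_sum]
      refine Finset.sum_congr rfl fun j₂ _ => ?_
      rw [QState.integral_measure, L.trace_circuit_apply, hs]
    · intro j₁ x hx
      rw [PMF.mem_support_bind_iff] at hx
      obtain ⟨j₂, _, hx⟩ := hx
      exact hb j₁ j₂ x hx
  have h2 : (L.op H * ρ.mat * (L.op H)ᴴ * O).trace = ∑ j₁, ∑ j₂, (L.coeff j₁ : ℂ) * (L.coeff j₂) *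
      (evolution H (L.time j₁) * ρ.mat * (evolution H (L.time j₂))ᴴ * O).trace := by
    simp only [EvolutionLCU.op, conjTranspose_sum, Finset.sum_mul, Finset.mul_sum,
      trace_sum, conjTranspose_smul, Matrix.smul_mul,
      Matrix.mul_smul, trace_smul, smul_eq_mul]
    rw [Finset.sum_comm]
    refine Finset.sum_congr rfl fun j₁ _ => Finset.sum_congr rfl fun j₂ _ => ?_
    simp [mul_assoc, mul_left_comm]
  have h3 : (L.op H * ρ.mat * (L.op H)ᴴ * O).trace = ∑ j₁, ∑ j₂, (L.coeff j₁ : ℂ) * (L.coeff j₂) *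
      (1 / 2 * ((evolution H (L.time j₂) * ρ.mat * (evolution H (L.time j₁))ᴴ * O).trace +
        (evolution H (L.time j₁) * ρ.mat * (evolution H (L.time j₂))ᴴ * O).trace)) := by
    have h4 : (L.op H * ρ.mat * (L.op H)ᴴ * O).trace = ∑ j₁, ∑ j₂,
        (L.coeff j₁ : ℂ) * (L.coeff j₂) *
        (evolution H (L.time j₂) * ρ.mat * (evolution H (L.time j₁))ᴴ * O).trace := by
      rw [h2, Finset.sum_comm]
      refine Finset.sum_congr rfl fun j₁ _ => Finset.sum_congr rfl fun j₂ _ => ?_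
      ring
    simp only [mul_add, Finset.sum_add_distrib, mul_left_comm _ (1 / 2 : ℂ), ← Finset.mul_sum]
    rw [← h2, ← h4]
    ring
  have hl := L.l1_pos.ne'
  rw [h1, h3, Finset.mul_sum, Complex.re_sum]
  refine Finset.sum_congr rfl fun j₁ _ => ?_
  rw [Finset.mul_sum, Complex.re_sum]
  refine Finset.sum_congr rfl fun j₂ _ => ?_
  rw [← Complex.ofReal_mul, Complex.re_ofReal_mul]
  field_simp

end Run

/-! ### Concentration of the sample mean -/

/-- Hoeffding's inequality: an outcome in `[-B, B]` is sub-Gaussian with variance proxy `B²`; the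
factor `2` is a union bound over the two tails. -/
theorem measureReal_pi_abs_sum_sub_ge_le {p : PMF ℝ} {B : ℝ} (hp : ∀ x ∈ p.support, |x| ≤ B)
    (hB : 0 ≤ B) (T : ℕ) {s : ℝ} (hs : 0 ≤ s) :
    (Measure.pi fun _ : Fin T => p.toMeasure).real
      {x | s ≤ |∑ k, x k - T * ∫ y, y ∂p.toMeasure|} ≤
      2 * Real.exp (-s ^ 2 / (2 * (T * B ^ 2))) := by
  set E := ∫ y, y ∂p.toMeasure with hE
  have hae : ∀ᵐ x ∂p.toMeasure, x ∈ Set.Icc (-B) B :=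
    ae_of_forall_mem_support measurableSet_Icc fun x hx => abs_le.mp (hp x hx)
  have hsub := ProbabilityTheory.hasSubgaussianMGF_of_mem_Icc (μ := p.toMeasure)
    (X := fun x => x) measurable_id.aemeasurable hae
  have hvar : (((‖B - -B‖₊ / 2) ^ 2 : NNReal) : ℝ) = B ^ 2 := by
    push_cast
    rw [Real.norm_of_nonneg (by linarith)]
    ring
  generalize (‖B - -B‖₊ / 2) ^ 2 = c at hsub hvar
  have hsubk : ∀ k : Fin T, ProbabilityTheory.HasSubgaussianMGF
      (fun x : Fin T → ℝ => x k - E) c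
      (Measure.pi fun _ : Fin T => p.toMeasure) := by
    intro k
    have hmp := measurePreserving_eval (fun _ : Fin T => p.toMeasure) k
    refine ProbabilityTheory.HasSubgaussianMGF.of_map (Y := fun x : Fin T → ℝ => x k)
      (X := fun x => x - E) hmp.measurable.aemeasurable ?_
    have := hmp.map_eq
    change Measure.map (fun x : Fin T → ℝ => x k) _ = _ at this
    rwa [this]
  have hind : ProbabilityTheory.iIndepFun (fun (k : Fin T) (x : Fin T → ℝ) => x k - E)
      (Measure.pi fun _ : Fin T => p.toMeasure) :=
    ProbabilityTheory.iIndepFun_pi (X := fun _ x => x - E) fun _ => by fun_prop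
  have hindn : ProbabilityTheory.iIndepFun (fun (k : Fin T) (x : Fin T → ℝ) => -(x k - E))
      (Measure.pi fun _ : Fin T => p.toMeasure) :=
    ProbabilityTheory.iIndepFun_pi (X := fun _ x => -(x - E)) fun _ => by fun_prop
  have h1 := ProbabilityTheory.HasSubgaussianMGF.measure_sum_ge_le_of_iIndepFun hind
    (s := Finset.univ) (fun k _ => hsubk k) hs
  have h2 := ProbabilityTheory.HasSubgaussianMGF.measure_sum_ge_le_of_iIndepFun hindn
    (s := Finset.univ) (fun k _ => (hsubk k).neg) hs
  simp only [Finset.sum_const, Finset.card_univ, Fintype.card_fin, nsmul_eq_mul,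
    Finset.sum_neg_distrib, Finset.sum_sub_distrib] at h1 h2
  push_cast at h1 h2
  rw [hvar] at h1 h2
  have hsubset : {x : Fin T → ℝ | s ≤ |∑ k, x k - T * E|} ⊆
      {x | s ≤ ∑ k, x k - T * E} ∪ {x | s ≤ -(∑ k, x k - T * E)} := fun x hx => by
    simpa only [Set.mem_union, Set.mem_ofPred_eq, le_abs] using hx
  calc _ ≤ _ := measureReal_mono hsubset
    _ ≤ _ := measureReal_union_le _ _
    _ ≤ _ := by rw [two_mul]; exact add_le_add h1 h2

/-- An error `a` in the rescaled mean is a deviation `a T / ‖c‖₁²` of the sum, so the Hoeffding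
exponent is `a² T / (2 ‖c‖₁⁴ B²)`, and `hT` makes it at least `log (2/δ)`. -/
theorem EvolutionLCU.expectationObservable_ge {d ι : Type} [Fintype d] [DecidableEq d] [Fintype ι]
    [Nonempty ι] (L : EvolutionLCU ι) {H : Matrix d d ℂ} (hH : H.IsHermitian) (ρ : QState d)
    {O : Matrix d d ℂ} (hO : O.IsHermitian) {T : ℕ} {B a δ : ℝ} (hB : 0 < B) (hOB : ‖O‖ ≤ B)
    (ha : 0 < a) (hδ : 0 < δ) (hT0 : 0 < T)
    (hT : 2 * L.l1 ^ 4 * B ^ 2 * Real.log (2 / δ) / a ^ 2 ≤ T) :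
    ENNReal.ofReal (1 - δ) ≤ L.expectationObservable hH ρ hO T
      {x | |x - (L.op H * ρ.mat * (L.op H)ᴴ * O).trace.re| ≤ a} := by
  have hl := L.l1_pos
  have hT0' : (0 : ℝ) < T := by exact_mod_cast hT0
  have hmeas : MeasurableSet {x : ℝ | |x - (L.op H * ρ.mat * (L.op H)ᴴ * O).trace.re| ≤ a} :=
    measurableSet_le (by fun_prop) measurable_const
  rw [EvolutionLCU.expectationObservable, Measure.map_apply (by fun_prop) hmeas,
    ← L.integral_run hH ρ hO]
  have h := measureReal_pi_abs_sum_sub_ge_le (p := L.run hH ρ hO) (B := B)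
    (fun x hx => (L.abs_le_of_mem_support_run hH ρ hO hx).trans hOB) hB.le T
    (s := a * T / L.l1 ^ 2) (by positivity)
  set P := Measure.pi fun _ : Fin T => (L.run hH ρ hO).toMeasure with hP
  set E := ∫ x, x ∂(L.run hH ρ hO).toMeasure with hE
  have hexp : 2 * Real.exp (-(a * T / L.l1 ^ 2) ^ 2 / (2 * (T * B ^ 2))) ≤ δ := by
    have h1 : -(a * T / L.l1 ^ 2) ^ 2 / (2 * (T * B ^ 2)) ≤ Real.log (δ / 2) := by
      have e : Real.log (δ / 2) = -Real.log (2 / δ) := by rw [← Real.log_inv, inv_div]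
      rw [e, neg_div, neg_le_neg_iff, le_div_iff₀ (by positivity)]
      rw [div_le_iff₀ (by positivity)] at hT
      rw [div_pow, le_div_iff₀ (by positivity)]
      have := mul_le_mul_of_nonneg_right hT hT0'.le
      calc _ = 2 * L.l1 ^ 4 * B ^ 2 * Real.log (2 / δ) * T := by ring
        _ ≤ _ := this
        _ = _ := by ring
    have h2 := Real.exp_le_exp.mpr h1
    rw [Real.exp_log (by positivity)] at h2
    linarith
  set S := {x : Fin T → ℝ | a * T / L.l1 ^ 2 ≤ |∑ k, x k - T * E|} with hS
  have hSm : MeasurableSet S := measurableSet_le measurable_const (by fun_prop)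
  have hsub : Sᶜ ⊆ (fun x : Fin T → ℝ => L.l1 ^ 2 / T * ∑ k, x k) ⁻¹'
      {x | |x - L.l1 ^ 2 * E| ≤ a} := by
    intro x hx
    simp only [hS, Set.mem_compl_iff, Set.mem_ofPred_eq, not_le] at hx
    have e : L.l1 ^ 2 / T * ∑ k, x k - L.l1 ^ 2 * E = L.l1 ^ 2 / T * (∑ k, x k - T * E) := by
      field_simp
    rw [Set.mem_preimage, Set.mem_ofPred_eq, e, abs_mul,
      abs_of_pos (by positivity : 0 < L.l1 ^ 2 / T)]
    calc _ ≤ L.l1 ^ 2 / T * (a * T / L.l1 ^ 2) := by gcongr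
      _ = a := by field_simp
  refine le_trans ?_ (measure_mono hsub)
  rw [← ofReal_measureReal, probReal_compl_eq_one_sub hSm]
  apply ENNReal.ofReal_le_ofReal
  linarith

/-! ### The Gaussian linear combination of time evolutions -/

section GaussLCU

variable {d : Type} [Fintype d] [DecidableEq d] {t γ : ℝ}

theorem gaussStep_inv (t γ : ℝ) :
    (gaussStep t γ)⁻¹ = Real.sqrt (2 * t) + Real.sqrt (2 * Real.log (5 / γ)) := inv_inv _

/-- Uniform in `t` and `M`: this is why the number of runs does not depend on the evolution time. -/
theorem gaussLCU_l1_le (t : ℝ) (hγ : γ ∈ Set.Ioo (0 : ℝ) 1) (M : ℕ) :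
    (gaussLCU t hγ M).l1 ≤ 3 / 2 := by
  have hδ := gaussStep_pos t hγ
  have h1 : (gaussLCU t hγ M).l1 =
      ∑ j ∈ Finset.Icc (-(M : ℤ)) (M : ℤ), gaussWeight (gaussStep t γ) j :=
    Finset.sum_coe_sort _ (gaussWeight (gaussStep t γ))
  have h2 := sum_gaussWeight_le hδ (r := γ / 5) (by linarith [hγ.1]) (by linarith [hγ.2]) (by
    rw [inv_div, gaussStep_inv]
    linarith [Real.sqrt_nonneg (2 * t)])
  rw [h1]
  exact ((summable_gaussWeight hδ).sum_le_tsum _ fun j _ => (gaussWeight_pos hδ j).le).trans h2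

theorem log_five_div_pos (hγ : γ ∈ Set.Ioo (0 : ℝ) 1) : 1 ≤ Real.log (5 / γ) := by
  have hγ0 := hγ.1
  rw [Real.le_log_iff_exp_le (by positivity), le_div_iff₀ hγ0]
  have := Real.exp_one_lt_d9
  nlinarith [hγ.2, Real.exp_pos 1]

theorem log_four_div_pos (hγ : γ ∈ Set.Ioo (0 : ℝ) 1) : 0 < Real.log (4 / γ) := by
  have hγ0 := hγ.1
  apply Real.log_pos
  rw [lt_div_iff₀ hγ0]
  linarith [hγ.2]

/-- The real number that is rounded up in `gaussOrder`, in units of the step. -/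
theorem gaussOrder_bound_mul_gaussStep (hγ : γ ∈ Set.Ioo (0 : ℝ) 1) :
    2 * (Real.sqrt t + Real.sqrt (Real.log (5 / γ))) * Real.sqrt (Real.log (4 / γ)) *
      gaussStep t γ = Real.sqrt 2 * Real.sqrt (Real.log (4 / γ)) := by
  have h5 := log_five_div_pos hγ
  have hq : 0 < Real.sqrt (Real.log (5 / γ)) := Real.sqrt_pos.mpr (by linarith)
  have h : gaussStep t γ =
      (Real.sqrt 2 * (Real.sqrt t + Real.sqrt (Real.log (5 / γ))))⁻¹ := by
    rw [gaussStep, Real.sqrt_mul zero_le_two, Real.sqrt_mul zero_le_two, mul_add]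
  have hs : 0 < Real.sqrt t + Real.sqrt (Real.log (5 / γ)) := by positivity
  have h2 : Real.sqrt 2 * Real.sqrt 2 = 2 := Real.mul_self_sqrt zero_le_two
  rw [h]
  field_simp
  rw [pow_two, h2, mul_comm]

theorem exp_gaussOrder_le (hγ : γ ∈ Set.Ioo (0 : ℝ) 1) :
    Real.exp (-((gaussOrder t γ : ℝ) ^ 2 * gaussStep t γ ^ 2 / 2)) ≤ γ / 4 := by
  have hδ := gaussStep_pos t hγ
  have h4 := log_four_div_pos hγ
  have h1 : Real.sqrt 2 * Real.sqrt (Real.log (4 / γ)) ≤ gaussOrder t γ * gaussStep t γ := by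
    rw [← gaussOrder_bound_mul_gaussStep hγ]
    gcongr
    exact Nat.le_ceil _
  have h2 := pow_le_pow_left₀ (by positivity) h1 2
  rw [mul_pow, Real.sq_sqrt zero_le_two, Real.sq_sqrt h4.le, mul_pow] at h2
  calc _ ≤ Real.exp (-Real.log (4 / γ)) := by apply Real.exp_le_exp.mpr; linarith
    _ = γ / 4 := by
      rw [← Real.log_inv, inv_div, Real.exp_log (by linarith [hγ.1])]

/-- The Gaussian linear combination of time evolutions approximates `exp (- t A²)`. -/
theorem norm_gaussLCU_op_sub_le {A : Matrix d d ℂ} (hA : A.IsHermitian)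
    (hspec : spectrum ℝ A ⊆ Set.Icc 0 1) (ht : 0 ≤ t) (hγ : γ ∈ Set.Ioo (0 : ℝ) 1) :
    ‖(gaussLCU t hγ (gaussOrder t γ)).op A - NormedSpace.exp ((-(t : ℂ)) • A ^ 2)‖ ≤ γ := by
  rw [op_eq_specFun _ hA, exp_neg_smul_sq_eq_specFun hA, specFun_sub]
  refine norm_specFun_le hA _ hγ.1.le fun x hx => ?_
  obtain ⟨hx0, hx1⟩ := hspec hx
  -- The frequency `y = √(2t) x` turns `exp (-y²/2)` into `exp (-t x²)`. The spectral bound `x ≤ 1`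
  -- is what lets the step `gaussStep t γ` resolve `y`.
  have h := norm_sum_gaussMode_sub_le (y := Real.sqrt (2 * t) * x) (gaussStep_pos t hγ) hγ
    (by positivity) (by
      rw [gaussStep_inv]
      gcongr
      exact mul_le_of_le_one_right (Real.sqrt_nonneg _) hx1) _ (exp_gaussOrder_le hγ)
  have hs : ∑ j, ((gaussLCU t hγ (gaussOrder t γ)).coeff j : ℂ) * Complex.exp
      (-(Complex.I * (((gaussLCU t hγ (gaussOrder t γ)).time j * x : ℝ) : ℂ))) =
      ∑ j ∈ Finset.Icc (-(gaussOrder t γ : ℤ)) (gaussOrder t γ : ℤ),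
        gaussMode (gaussStep t γ) (Real.sqrt (2 * t) * x) j := by
    rw [← Finset.sum_coe_sort (Finset.Icc (-(gaussOrder t γ : ℤ)) (gaussOrder t γ : ℤ))]
    refine Finset.sum_congr rfl fun j _ => ?_
    simp only [gaussMode, gaussWeight, gaussLCU, mul_assoc]
  have he : -((Real.sqrt (2 * t) * x) ^ 2 / 2) = -(t * x ^ 2) := by
    rw [mul_pow, Real.sq_sqrt (by positivity)]; ring
  rw [hs]
  rwa [he] at h

/-- Before rounding, the truncation order times the step is `√2 √(log (4/γ))`. The ceiling adds at
most one step, which is at most `1`. -/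
theorem abs_gaussLCU_time_le (hγ : γ ∈ Set.Ioo (0 : ℝ) 1) {M : ℕ}
    (hM : M ≤ gaussOrder t γ) (j : GaussIndex M) :
    |(gaussLCU t hγ M).time j| ≤
      (Real.sqrt 2 * Real.sqrt (Real.log (4 / γ)) + 1) * Real.sqrt (2 * t) := by
  have hδ := gaussStep_pos t hγ
  obtain ⟨j, hj⟩ := j
  rw [Finset.mem_Icc] at hj
  have hj' : |(j : ℝ)| ≤ gaussOrder t γ := by
    have h1 : |j| ≤ (gaussOrder t γ : ℤ) := abs_le.mpr ⟨by omega, by omega⟩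
    exact_mod_cast h1
  have hδ1 : gaussStep t γ ≤ 1 := by
    have h5 := log_five_div_pos hγ
    have h6 : 1 ≤ Real.sqrt (2 * Real.log (5 / γ)) := Real.one_le_sqrt.mpr (by linarith)
    exact inv_le_one_of_one_le₀ (by linarith [Real.sqrt_nonneg (2 * t)])
  have h : (gaussOrder t γ : ℝ) * gaussStep t γ ≤
      Real.sqrt 2 * Real.sqrt (Real.log (4 / γ)) + 1 := by
    have h1 : (gaussOrder t γ : ℝ) ≤ 2 * (Real.sqrt t + Real.sqrt (Real.log (5 / γ))) *
        Real.sqrt (Real.log (4 / γ)) + 1 := (Nat.ceil_lt_add_one (by positivity)).le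
    calc _ ≤ _ := mul_le_mul_of_nonneg_right h1 hδ.le
      _ = Real.sqrt 2 * Real.sqrt (Real.log (4 / γ)) + gaussStep t γ := by
        rw [add_mul, gaussOrder_bound_mul_gaussStep hγ, one_mul]
      _ ≤ _ := by linarith
  change |(j : ℝ) * gaussStep t γ * Real.sqrt (2 * t)| ≤ _
  rw [abs_mul, abs_mul, abs_of_pos hδ, abs_of_nonneg (Real.sqrt_nonneg (2 * t))]
  gcongr
  exact (mul_le_mul_of_nonneg_right hj' hδ.le).trans h

theorem maxTime_circuit_le {ι : Type} (L : EvolutionLCU ι) {B : ℝ} (hB : ∀ j, |L.time j| ≤ B)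
    (j₁ j₂ : ι) : (L.circuit j₁ j₂).maxTime ≤ B := by
  simp [Circuit.maxTime, EvolutionLCU.circuit, hB]

/-- The evolution time in terms of the logarithm of the accuracy. -/
theorem sqrt_log_mul_sqrt_le {K L G Δ : ℝ} (hK : 0 < K) (hL : 1 / 4 ≤ L) (hΔ : 0 < Δ)
    (ht : t ≤ K * (1 / Δ ^ 2 * L)) (hG : G ≤ 500 * L) :
    (Real.sqrt 2 * Real.sqrt G + 1) * Real.sqrt (2 * t) ≤
      40 * Real.sqrt (2 * K) * (1 / Δ * L) := by
  have hL0 : 0 < L := by linarith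
  set l := Real.sqrt L with hl
  have hl2 : l * l = L := Real.mul_self_sqrt hL0.le
  have hl0 : 1 / 2 ≤ l := Real.le_sqrt_of_sq_le (by linarith)
  -- Since `√1000 < 38`, the main term is at most `38 l`; the extra `1` is at most `2 l` because `l
  -- ≥ 1/2`, giving the factor `40`.
  have h1 : Real.sqrt 2 * Real.sqrt G ≤ 38 * l := by
    rw [← Real.sqrt_mul zero_le_two]
    refine Real.sqrt_le_iff.mpr ⟨by positivity, ?_⟩
    nlinarith
  have h2 : Real.sqrt (2 * t) ≤ Real.sqrt (2 * K) * (l / Δ) := by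
    refine Real.sqrt_le_iff.mpr ⟨by positivity, ?_⟩
    rw [mul_pow, Real.sq_sqrt (by positivity), div_pow, pow_two l, hl2]
    calc 2 * t ≤ 2 * (K * (1 / Δ ^ 2 * L)) := by linarith
      _ = _ := by ring
  calc _ ≤ (40 * l) * (Real.sqrt (2 * K) * (l / Δ)) := by
        gcongr
        linarith
    _ = _ := by rw [← hl2]; ring

end GaussLCU

/-! ### Filtering the ground state -/

theorem norm_toLp_sq {d : Type} [Fintype d] (x : d → ℂ) :
    ‖WithLp.toLp 2 x‖ ^ 2 = (star x ⬝ᵥ x).re := by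
  rw [← inner_self_eq_norm_sq (𝕜 := ℂ), EuclideanSpace.inner_toLp_toLp, dotProduct_comm]
  rfl

theorem star_dotProduct_comm {d : Type} [Fintype d] (x y : d → ℂ) :
    star x ⬝ᵥ y = star (star y ⬝ᵥ x) := by
  rw [star_dotProduct]

theorem norm_sq_sub_smul {d : Type} [Fintype d] {v ψ : d → ℂ} (hv : star v ⬝ᵥ v = 1)
    (hψ : star ψ ⬝ᵥ ψ = 1) :
    ‖WithLp.toLp 2 (ψ - (star v ⬝ᵥ ψ) • v)‖ ^ 2 = 1 - ‖star v ⬝ᵥ ψ‖ ^ 2 := by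
  rw [norm_toLp_sq, star_sub, star_smul, sub_dotProduct, dotProduct_sub, dotProduct_sub,
    smul_dotProduct, smul_dotProduct, dotProduct_smul, dotProduct_smul, hv, hψ,
    star_dotProduct_comm ψ v]
  simp only [smul_eq_mul, mul_one, sub_self, sub_zero, Complex.star_def,
    Complex.mul_conj, Complex.normSq_eq_norm_sq, Complex.sub_re, Complex.one_re,
    Complex.ofReal_re]

section Ground

variable {d : Type} [Fintype d] [DecidableEq d]

theorem mem_spectrum_shifted {H : Matrix d d ℂ} {a x : ℝ} (hx : x ∈ spectrum ℝ (shifted H a)) :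
    x + a ∈ spectrum ℝ H := by
  have h : shifted H a = -(algebraMap ℝ (Matrix d d ℂ) a) + H := by
    rw [shifted, sub_eq_neg_add, Algebra.algebraMap_eq_smul_one]
    rfl
  rw [h] at hx
  exact spectrum.add_mem_iff.mpr hx

theorem shifted_mulVec {H : Matrix d d ℂ} {a : ℝ} (w : d → ℂ) :
    shifted H a *ᵥ w = H *ᵥ w - (a : ℂ) • w := by
  rw [shifted, sub_mulVec, smul_mulVec, one_mulVec]

theorem star_dotProduct_specFun_mulVec {A : Matrix d d ℂ} (hA : A.IsHermitian) {f : ℝ → ℂ}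
    (hf : ∀ x, star (f x) = f x) (u w : d → ℂ) :
    star u ⬝ᵥ (specFun hA f *ᵥ w) = star (specFun hA f *ᵥ u) ⬝ᵥ w := by
  rw [star_mulVec, specFun_conjTranspose, ← dotProduct_mulVec]
  simp only [hf]

/-- The component of the initial state off the ground state is damped by a function that is small
above the gap. -/
theorem IsGappedGroundState.norm_specFun_mulVec_le {H : Matrix d d ℂ} {lam₀ Δ a : ℝ}
    {v ψ : d → ℂ} (g : IsGappedGroundState H lam₀ Δ v ψ) (hA : (shifted H a).IsHermitian)
    (f : ℝ → ℂ) {B : ℝ} (hB : 0 ≤ B) (hf : ∀ x, lam₀ - a + Δ ≤ x → ‖f x‖ ≤ B) :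
    ‖WithLp.toLp 2 (specFun hA f *ᵥ (ψ - (star v ⬝ᵥ ψ) • v))‖ ≤
      B * ‖WithLp.toLp 2 (ψ - (star v ⬝ᵥ ψ) • v)‖ := by
  set w := ψ - (star v ⬝ᵥ ψ) • v with hw
  set P := specFun hA (fun y => if y = lam₀ - a then 1 else 0) with hP
  have hAv : shifted H a *ᵥ v = ((lam₀ - a : ℝ) : ℂ) • v := by
    rw [shifted_mulVec, g.eigen, ← sub_smul, Complex.ofReal_sub]
  have hHP : H *ᵥ (P *ᵥ w) = (lam₀ : ℂ) • (P *ᵥ w) := by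
    have h := mulVec_specFun_ite hA (lam₀ - a) w
    rw [← hP, shifted_mulVec, Complex.ofReal_sub, sub_smul] at h
    exact sub_left_injective h
  have hsa : ∀ y : ℝ, star (if y = lam₀ - a then (1 : ℂ) else 0) =
      if y = lam₀ - a then 1 else 0 := fun y => by split_ifs <;> simp
  have hvw : star v ⬝ᵥ w = 0 := by
    rw [hw, dotProduct_sub, dotProduct_smul, g.unit, smul_eq_mul, mul_one, sub_self]
  have hvP : star v ⬝ᵥ (P *ᵥ w) = 0 := by
    rw [hP, star_dotProduct_specFun_mulVec hA hsa, specFun_mulVec hA _ hAv, if_pos rfl, one_smul,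
      hvw]
  have hPv : star (P *ᵥ w) ⬝ᵥ v = 0 := by
    rw [star_dotProduct_comm, hvP, star_zero]
  -- `P w` is a ground vector orthogonal to `v`, so `g.proj` makes it orthogonal to `ψ`, hence to
  -- `w`; thus `‖P w‖² = ⟨P w, w⟩ = 0`. This covers degenerate ground spaces.
  have hPP : star (P *ᵥ w) ⬝ᵥ (P *ᵥ w) = 0 := by
    have h1 : P *ᵥ (P *ᵥ w) = P *ᵥ w := by
      rw [mulVec_mulVec, hP, specFun_mul]
      congr 2; ext y; split_ifs <;> simp
    have h2 : star (P *ᵥ w) ⬝ᵥ w = 0 := by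
      nth_rewrite 2 [hw]
      rw [dotProduct_sub, dotProduct_smul, hPv, smul_zero, sub_zero]
      exact g.proj _ hHP hvP
    nth_rewrite 2 [hP]
    rw [star_dotProduct_specFun_mulVec hA hsa, ← hP, h1, h2]
  have hPw : P *ᵥ w = 0 := dotProduct_star_self_eq_zero.mp hPP
  -- Because `P w = 0`, the value of `f` at the ground energy can be replaced by `0`, leaving only
  -- the values above the gap in the operator norm.
  have hfg : specFun hA f *ᵥ w =
      specFun hA (fun y => f y - f (lam₀ - a) * if y = lam₀ - a then 1 else 0) *ᵥ w := by
    rw [← specFun_sub, sub_mulVec, ← specFun_smul, smul_mulVec, ← hP, hPw, smul_zero, sub_zero]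
  rw [hfg]
  refine (norm_toLp_mulVec_le _ _).trans
    (mul_le_mul_of_nonneg_right (norm_specFun_le hA _ hB fun x hx => ?_) (norm_nonneg _))
  rcases g.gap _ (mem_spectrum_shifted hx) with h | h
  · have hx' : x = lam₀ - a := by linarith
    rw [if_pos hx', mul_one, hx', sub_self, norm_zero]
    exact hB
  · split_ifs with h0
    · rw [h0, mul_one, sub_self, norm_zero]; exact hB
    · rw [mul_zero, sub_zero]; exact hf x (by linarith)

end Ground

/-! ### Accuracy of the output -/

/-- Estimates of `⟨ψ|X† O X|ψ⟩` and `⟨ψ|X† X|ψ⟩` determine the ground state expectation value of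
`O` if `X` is close to `exp (- t (H - a)²)`. -/
theorem IsGappedGroundState.abs_div_sub_le {d : Type} [Fintype d] [DecidableEq d]
    {H O X : Matrix d d ℂ} {lam₀ Δ a t ε η μ l : ℝ} {v ψ : d → ℂ}
    (g : IsGappedGroundState H lam₀ Δ v ψ) (hψ : star ψ ⬝ᵥ ψ = 1)
    (hA : (shifted H a).IsHermitian) (hO : O.IsHermitian) (hΔ : 0 ≤ Δ) (ht : 0 ≤ t)
    (hε : 0 < ε) (hε1 : ε < 1) (hεO : ε ≤ ‖O‖) (hη : 0 < η) (hη1 : η ≤ 1)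
    (hvψ : η ≤ ‖star v ⬝ᵥ ψ‖) (ha : 0 ≤ lam₀ - a) (hat : t * (lam₀ - a) ^ 2 ≤ 1 / 20)
    (htΔ : 8 * ‖O‖ ^ 2 * (Real.exp (-(2 * t * Δ ^ 2)) * (1 - η ^ 2)) ≤ ε ^ 2 * η ^ 2)
    (hX : ‖X - NormedSpace.exp ((-(t : ℂ)) • shifted H a ^ 2)‖ ≤ ε * η ^ 2 / (30 * ‖O‖))
    (hμ : |μ - (star (X *ᵥ ψ) ⬝ᵥ (O *ᵥ (X *ᵥ ψ))).re| ≤ ε * η ^ 2 / 100)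
    (hl : |l - (star (X *ᵥ ψ) ⬝ᵥ (X *ᵥ ψ)).re| ≤ ε * η ^ 2 / (100 * ‖O‖)) :
    l ≠ 0 ∧ |μ / l - (star v ⬝ᵥ (O *ᵥ v)).re| ≤ ε := by
  set f : ℝ → ℂ := fun x => ((Real.exp (-(t * x ^ 2)) : ℝ) : ℂ) with hf
  set α := star v ⬝ᵥ ψ with hα
  set w := ψ - α • v with hw
  set lam := lam₀ - a with hlam
  have hnf : ∀ x, ‖f x‖ = Real.exp (-(t * x ^ 2)) := fun x => by
    rw [hf, Complex.norm_real, Real.norm_of_nonneg (Real.exp_pos _).le]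
  have hAv : shifted H a *ᵥ v = (lam : ℂ) • v := by
    rw [shifted_mulVec, g.eigen, ← sub_smul, hlam, Complex.ofReal_sub]
  have hFv := specFun_mulVec hA f hAv
  have hψv : specFun hA f *ᵥ ψ = (f lam * α) • v + specFun hA f *ᵥ w := by
    have : ψ = α • v + w := by rw [hw]; abel
    nth_rewrite 1 [this]
    rw [mulVec_add, mulVec_smul, hFv, smul_smul, mul_comm]
  have hvw : star v ⬝ᵥ w = 0 := by
    rw [hw, dotProduct_sub, dotProduct_smul, g.unit, smul_eq_mul, mul_one, sub_self]
  have hβ : ‖f lam * α‖ ^ 2 = Real.exp (-(2 * (t * lam ^ 2))) * ‖α‖ ^ 2 := by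
    rw [norm_mul, mul_pow, hnf, ← Real.exp_nat_mul]
    congr 2; push_cast; ring
  have hα2 : η ^ 2 ≤ ‖α‖ ^ 2 := pow_le_pow_left₀ hη.le hvψ 2
  have hnormv : ‖WithLp.toLp 2 v‖ = 1 := by
    have h := norm_toLp_sq v
    rw [g.unit, Complex.one_re] at h
    exact (pow_eq_one_iff_of_nonneg (norm_nonneg _) two_ne_zero).mp h
  have hnormψ : ‖WithLp.toLp 2 ψ‖ = 1 := by
    have h := norm_toLp_sq ψ
    rw [hψ, Complex.one_re] at h
    exact (pow_eq_one_iff_of_nonneg (norm_nonneg _) two_ne_zero).mp h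
  have hinner : ∀ x : d → ℂ, inner ℂ (WithLp.toLp 2 x)
      (toEuclideanCLM (n := d) (𝕜 := ℂ) O (WithLp.toLp 2 x)) = star x ⬝ᵥ (O *ᵥ x) := fun x => by
    rw [toEuclideanCLM_toLp, EuclideanSpace.inner_toLp_toLp, dotProduct_comm]
  have hsymm : (toEuclideanCLM (n := d) (𝕜 := ℂ) O).IsSymmetric := by
    intro x y
    change inner ℂ (WithLp.toLp 2 (O *ᵥ x.ofLp)) (WithLp.toLp 2 y.ofLp) =
      inner ℂ (WithLp.toLp 2 x.ofLp) (WithLp.toLp 2 (O *ᵥ y.ofLp))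
    rw [EuclideanSpace.inner_toLp_toLp, EuclideanSpace.inner_toLp_toLp, star_mulVec, hO.eq,
      dotProduct_comm, ← dotProduct_mulVec, dotProduct_comm]
  have hφ : (f lam * α) • WithLp.toLp 2 v + WithLp.toLp 2 (specFun hA f *ᵥ w) =
      WithLp.toLp 2 (specFun hA f *ᵥ ψ) := by
    rw [hψv, WithLp.toLp_add, WithLp.toLp_smul]
  have hO' := Matrix.l2_opNorm_toEuclideanCLM O
  have key := abs_div_sub_re_inner_le (μ := μ) (l := l) (x := WithLp.toLp 2 (X *ᵥ ψ)) hsymm hnormv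
    (R := WithLp.toLp 2 (specFun hA f *ᵥ w)) (β := f lam * α) (ε := ε) (η := η)
  rw [hφ, hinner, hinner, norm_toLp_sq (X *ᵥ ψ), hO'] at key
  refine key ?_ hε hε1 hεO hη hη1 ?_ ?_ ?_ ?_ hμ hl
  · rw [EuclideanSpace.inner_toLp_toLp, dotProduct_comm,
      star_dotProduct_specFun_mulVec hA (fun x => Complex.conj_ofReal _), hFv, star_smul,
      smul_dotProduct, hvw, smul_zero]
  -- Keeping `lam²` in the exponent is essential: the factor `exp (-2 t lam²)` then also occurs in
  -- `‖β‖²` and drops out of the comparison.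
  · have h1 := g.norm_specFun_mulVec_le hA f (B := Real.exp (-(t * (lam ^ 2 + Δ ^ 2))))
      (Real.exp_pos _).le (fun x hx => by
        rw [hnf]
        apply Real.exp_le_exp.mpr
        have : lam ^ 2 + Δ ^ 2 ≤ x ^ 2 := by nlinarith [mul_nonneg ha hΔ]
        nlinarith [mul_le_mul_of_nonneg_left this ht])
    have h2 := pow_le_pow_left₀ (norm_nonneg _) h1 2
    rw [mul_pow, norm_sq_sub_smul g.unit hψ, ← Real.exp_nat_mul] at h2
    have h3 : Real.exp ((2 : ℕ) * -(t * (lam ^ 2 + Δ ^ 2))) =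
        Real.exp (-(2 * (t * lam ^ 2))) * Real.exp (-(2 * t * Δ ^ 2)) := by
      rw [← Real.exp_add]; congr 1; push_cast; ring
    rw [h3] at h2
    rw [hβ]
    calc 8 * ‖O‖ ^ 2 * ‖WithLp.toLp 2 (specFun hA f *ᵥ w)‖ ^ 2
        ≤ 8 * ‖O‖ ^ 2 * (Real.exp (-(2 * (t * lam ^ 2))) * Real.exp (-(2 * t * Δ ^ 2)) *
            (1 - ‖α‖ ^ 2)) := by gcongr
      _ ≤ 8 * ‖O‖ ^ 2 * (Real.exp (-(2 * (t * lam ^ 2))) * Real.exp (-(2 * t * Δ ^ 2)) *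
            (1 - η ^ 2)) := by gcongr
      _ = Real.exp (-(2 * (t * lam ^ 2))) *
            (8 * ‖O‖ ^ 2 * (Real.exp (-(2 * t * Δ ^ 2)) * (1 - η ^ 2))) := by ring
      _ ≤ Real.exp (-(2 * (t * lam ^ 2))) * (ε ^ 2 * ‖α‖ ^ 2) := by
        refine mul_le_mul_of_nonneg_left (htΔ.trans ?_) (Real.exp_pos _).le
        gcongr
      _ = _ := by ring
  · rw [hβ]
    have h1 : 9 / 10 ≤ Real.exp (-(2 * (t * lam ^ 2))) := by
      linarith [Real.add_one_le_exp (-(2 * (t * lam ^ 2)))]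
    gcongr
  · refine (norm_toLp_mulVec_le _ _).trans ?_
    rw [hnormψ, mul_one]
    refine norm_specFun_le hA f zero_le_one fun x _ => ?_
    rw [hnf, Real.exp_le_one_iff]
    nlinarith [mul_nonneg ht (sq_nonneg x)]
  · rw [← WithLp.toLp_sub, ← sub_mulVec]
    refine (norm_toLp_mulVec_le _ _).trans ?_
    rw [hnormψ, mul_one]
    rwa [exp_neg_smul_sq_eq_specFun hA] at hX

/-! ### Elementary inequalities between the parameters -/

section Parameters

variable {B ε η : ℝ}

/-- As `η ≤ 1/√2`, the argument is at least `√2`, and `log √2 > 1/4`. This lets additive constants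
be absorbed into the logarithm. -/
theorem one_fourth_le_log (hε : 0 < ε) (hεB : ε ≤ B) (hη : η ∈ Set.Ioc (0 : ℝ) (1 / Real.sqrt 2)) :
    1 / 4 ≤ Real.log (B / (ε * η)) := by
  have h1 : Real.sqrt 2 ≤ B / (ε * η) := by
    rw [le_div_iff₀ (mul_pos hε hη.1)]
    have h2 := (le_div_iff₀ (Real.sqrt_pos.mpr zero_lt_two)).mp hη.2
    calc _ = ε * (η * Real.sqrt 2) := by ring
      _ ≤ ε * 1 := by gcongr
      _ ≤ B := by linarith
  have h2 := Real.log_le_log (Real.sqrt_pos.mpr zero_lt_two) h1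
  rw [Real.log_sqrt zero_le_two] at h2
  linarith [Real.log_two_gt_d9]

/-- The left argument is at most `120 (B / (ε η))²`; the crude `log 120 ≤ 119` is absorbed as `476`
times the logarithm. -/
theorem log_four_div_le (hε : 0 < ε) (hεB : ε ≤ B)
    (hη : η ∈ Set.Ioc (0 : ℝ) (1 / Real.sqrt 2)) :
    Real.log (4 / (ε * η ^ 2 / (30 * B))) ≤ 500 * Real.log (B / (ε * η)) := by
  have hη0 := hη.1
  have hB : 0 < B := hε.trans_le hεB
  have hL := one_fourth_le_log hε hεB hη
  have h1 : 4 / (ε * η ^ 2 / (30 * B)) ≤ 120 * (B / (ε * η)) ^ 2 := by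
    have : 4 / (ε * η ^ 2 / (30 * B)) = 120 * (B * ε / (ε * η) ^ 2) := by field_simp; norm_num
    rw [this, div_pow, pow_two B]
    gcongr
  have h2 := Real.log_le_log (by positivity) h1
  rw [Real.log_mul (by norm_num) (by positivity), Real.log_pow] at h2
  have h3 : Real.log 120 ≤ 119 := by
    linarith [Real.log_le_sub_one_of_pos (show (0 : ℝ) < 120 by norm_num)]
  push_cast at h2
  linarith

/-- Makes the logarithm in the lower bound on `t` nonnegative, so that `t ≥ 0`. -/
theorem eight_le_div (hε : 0 < ε) (hεB : ε ≤ B) (hη : η ∈ Set.Ioc (0 : ℝ) (1 / Real.sqrt 2)) :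
    8 ≤ 8 * B ^ 2 * (1 - η ^ 2) / (ε ^ 2 * η ^ 2) := by
  have hη0 := hη.1
  have h1 : η ^ 2 ≤ 1 / 2 := by
    have := pow_le_pow_left₀ hη0.le hη.2 2
    rwa [div_pow, Real.sq_sqrt zero_le_two, one_pow] at this
  rw [le_div_iff₀ (by positivity)]
  have h2 : ε ^ 2 ≤ B ^ 2 := by gcongr
  have h3 : ε ^ 2 * η ^ 2 ≤ B ^ 2 * (1 - η ^ 2) := by
    apply mul_le_mul h2 (by linarith) (by positivity) (by positivity)
  linarith

end Parameters

end SingleAncilla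

end

/-! ### Choice of constants and assembly -/

theorem mainTheorem7 (K : ℝ) (hK : 0 < K) :
    ∃ κ : ℝ, 0 < κ ∧ ∃ C : ℝ, 0 < C ∧
      ∀ (N : ℕ) (H : Matrix (Fin N) (Fin N) ℂ) (hH : H.IsHermitian)
        (O : Matrix (Fin N) (Fin N) ℂ) (hO : O.IsHermitian)
        (v₀ ψ₀ : Fin N → ℂ) (hψ₀ : star ψ₀ ⬝ᵥ ψ₀ = 1)
        (lam₀ Δ E₀ εg ε δ γ η t : ℝ) (hγ : γ ∈ Set.Ioo (0 : ℝ) 1),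
        ε ∈ Set.Ioo (0 : ℝ) 1 → δ ∈ Set.Ioo (0 : ℝ) 1 → η ∈ Set.Ioc (0 : ℝ) (1 / Real.sqrt 2) →
        ε ≤ ‖O‖ →
        0 < Δ → SingleAncilla.IsGappedGroundState H lam₀ Δ v₀ ψ₀ →
        η ≤ ‖star v₀ ⬝ᵥ ψ₀‖ →
        |lam₀ - E₀| ≤ εg → εg ≤ κ * (Δ / Real.sqrt (Real.log (‖O‖ / (ε * η)))) →
        spectrum ℝ (SingleAncilla.shifted H (E₀ - εg)) ⊆ Set.Icc 0 1 →
        1 / (2 * Δ ^ 2) * Real.log (8 * ‖O‖ ^ 2 * (1 - η ^ 2) / (ε ^ 2 * η ^ 2)) ≤ t →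
        t ≤ K * (1 / Δ ^ 2 * Real.log (‖O‖ / (ε * η))) →
        γ = ε * η ^ 2 / (30 * ‖O‖) →
        -- the Gaussian LCU approximates `exp (- t H²)`
        ‖(SingleAncilla.gaussLCU t hγ (SingleAncilla.gaussOrder t γ)).op
              (SingleAncilla.shifted H (E₀ - εg)) -
            NormedSpace.exp ((-(t : ℂ)) • (SingleAncilla.shifted H (E₀ - εg)) ^ 2)‖ ≤ γ ∧
        -- maximal time of evolution in a coherent run
        (∀ M : ℕ, M ≤ SingleAncilla.gaussOrder t γ → ∀ j₁ j₂ : SingleAncilla.GaussIndex M,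
          ((SingleAncilla.gaussLCU t hγ M).circuit j₁ j₂).maxTime ≤
            C * (1 / Δ * Real.log (‖O‖ / (ε * η)))) ∧
        -- number of runs and correctness
        (∀ M : ℕ,
          ‖(SingleAncilla.gaussLCU t hγ M).op (SingleAncilla.shifted H (E₀ - εg)) -
            NormedSpace.exp ((-(t : ℂ)) • (SingleAncilla.shifted H (E₀ - εg)) ^ 2)‖ ≤ γ →
          ∀ T : ℕ, C * (‖O‖ ^ 2 * Real.log (2 / δ) / (ε ^ 2 * η ^ 4)) ≤ (T : ℝ) →
            ENNReal.ofReal ((1 - δ) ^ 2) ≤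
              (SingleAncilla.gaussLCU t hγ M).singleAncillaLCU
                (SingleAncilla.shifted_isHermitian hH (E₀ - εg))
                (SingleAncilla.QState.ofVec ψ₀ hψ₀) hO T
                {p : ℝ × ℝ | p.2 ≠ 0 ∧
                  |p.1 / p.2 - (star v₀ ⬝ᵥ (O *ᵥ v₀)).re| ≤ ε}) := by

  -- The shifted ground energy is at most `2 εg`, so `t` times its square is at most `4 K κ²`, which
  -- is to be `1/20`.
  set κ := Real.sqrt (1 / (80 * K)) with hκ
  have hκ0 : 0 < κ := Real.sqrt_pos.mpr (by positivity)
  have hκ2 : κ ^ 2 = 1 / (80 * K) := Real.sq_sqrt (by positivity)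
  -- The first summand of `C` bounds the evolution time. The second is `20000 · 5.1`, from `2 ·
  -- 100²` in Hoeffding's bound with accuracy `ε η² / 100` and from `‖c‖₁⁴ ≤ (3/2)⁴ ≤ 5.1`.
  refine ⟨κ, hκ0, 40 * Real.sqrt (2 * K) + 102000, by positivity, ?_⟩
  intro N H hH O hO v₀ ψ₀ hψ₀ lam₀ Δ E₀ εg ε δ γ η t hγ hε hδ hη hεO hΔ g hvψ hE hεg hspec
    htl htu hγe
  have hε0 := hε.1
  have hη0 := hη.1
  have hδ0 := hδ.1
  have hO0 : 0 < ‖O‖ := hε0.trans_le hεO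
  have hL := SingleAncilla.one_fourth_le_log hε0 hεO hη
  set L := Real.log (‖O‖ / (ε * η)) with hLdef
  have hL0 : 0 < L := by linarith
  have hη1 : η ≤ 1 := hη.2.trans (by
    rw [div_le_one (Real.sqrt_pos.mpr zero_lt_two)]
    exact Real.one_le_sqrt.mpr one_le_two)
  have hQ := SingleAncilla.eight_le_div hε0 hεO hη
  set Q := 8 * ‖O‖ ^ 2 * (1 - η ^ 2) / (ε ^ 2 * η ^ 2) with hQdef
  have hlogQ : 0 ≤ Real.log Q := Real.log_nonneg (by linarith)
  have ht : 0 ≤ t := le_trans (by positivity) htl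
  have hA := SingleAncilla.shifted_isHermitian hH (E₀ - εg)
  refine ⟨SingleAncilla.norm_gaussLCU_op_sub_le hA hspec ht hγ, ?_, ?_⟩
  · intro M hM j₁ j₂
    refine (SingleAncilla.maxTime_circuit_le _
      (SingleAncilla.abs_gaussLCU_time_le hγ hM) j₁ j₂).trans ?_
    refine (SingleAncilla.sqrt_log_mul_sqrt_le hK hL hΔ htu ?_).trans ?_
    · rw [hγe]
      exact SingleAncilla.log_four_div_le hε0 hεO hη
    · gcongr
      linarith
  · intro M hM T hT
    have hlog2 : 0 < Real.log (2 / δ) := Real.log_pos (by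
      rw [lt_div_iff₀ hδ0]; linarith [hδ.2])
    have hlam0 : 0 ≤ lam₀ - (E₀ - εg) := by linarith [(abs_le.mp hE).1]
    have hlam1 : lam₀ - (E₀ - εg) ≤ 2 * (κ * (Δ / Real.sqrt L)) := by
      linarith [(abs_le.mp hE).2]
    have hat : t * (lam₀ - (E₀ - εg)) ^ 2 ≤ 1 / 20 := by
      have h1 := pow_le_pow_left₀ hlam0 hlam1 2
      calc t * (lam₀ - (E₀ - εg)) ^ 2
          ≤ K * (1 / Δ ^ 2 * L) * (2 * (κ * (Δ / Real.sqrt L))) ^ 2 := by gcongr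
        _ = K * (1 / Δ ^ 2 * L) * (4 * (κ ^ 2 * (Δ ^ 2 / Real.sqrt L ^ 2))) := by ring
        _ = 1 / 20 := by
          rw [hκ2, Real.sq_sqrt hL0.le]
          field_simp
          norm_num
    have htΔ : 8 * ‖O‖ ^ 2 * (Real.exp (-(2 * t * Δ ^ 2)) * (1 - η ^ 2)) ≤ ε ^ 2 * η ^ 2 := by
      have h1 : Real.log Q ≤ 2 * t * Δ ^ 2 := by
        have h2 := mul_le_mul_of_nonneg_right htl (by positivity : 0 ≤ 2 * Δ ^ 2)
        have h3 : 1 / (2 * Δ ^ 2) * Real.log Q * (2 * Δ ^ 2) = Real.log Q := by field_simp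
        linarith
      have h2 : Q ≤ Real.exp (2 * t * Δ ^ 2) := (Real.log_le_iff_le_exp (by linarith)).mp h1
      rw [hQdef, div_le_iff₀ (by positivity)] at h2
      rw [Real.exp_neg]
      calc _ = 8 * ‖O‖ ^ 2 * (1 - η ^ 2) / Real.exp (2 * t * Δ ^ 2) := by ring
        _ ≤ _ := by rw [div_le_iff₀ (Real.exp_pos _)]; linarith
    set Lc := SingleAncilla.gaussLCU t hγ M with hLc
    have hl1 : Lc.l1 ^ 4 ≤ 51 / 10 := by
      have := pow_le_pow_left₀ Lc.l1_pos.le (SingleAncilla.gaussLCU_l1_le t hγ M) 4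
      linarith
    have hT' : 102000 * (‖O‖ ^ 2 * Real.log (2 / δ) / (ε ^ 2 * η ^ 4)) ≤ T :=
      le_trans (by gcongr; linarith [Real.sqrt_nonneg (2 * K)]) hT
    have hT0 : 0 < T := by
      have : (0 : ℝ) < T := lt_of_lt_of_le (by positivity) hT'
      exact_mod_cast this
    have hone : ‖(1 : Matrix (Fin N) (Fin N) ℂ)‖ ≤ 1 := by
      rw [← Matrix.diagonal_one, Matrix.l2_opNorm_diagonal]
      exact (pi_norm_le_iff_of_nonneg zero_le_one).mpr fun i => by simp
    have hc1 := Lc.expectationObservable_ge hA (SingleAncilla.QState.ofVec ψ₀ hψ₀) hO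
      (T := T) (B := ‖O‖) (a := ε * η ^ 2 / 100) hO0 le_rfl (by positivity) hδ0 hT0 (by
        refine le_trans ?_ hT'
        calc _ = 20000 * Lc.l1 ^ 4 * (‖O‖ ^ 2 * Real.log (2 / δ) / (ε ^ 2 * η ^ 4)) := by
              field_simp; ring
          _ ≤ _ := by gcongr; linarith)
    -- For the identity the outcomes are bounded by `1` and the required accuracy is finer by the
    -- factor `‖O‖`; the two effects balance, so the same `T` serves both calls.
    have hc2 := Lc.expectationObservable_ge hA (SingleAncilla.QState.ofVec ψ₀ hψ₀)
      (O := (1 : Matrix (Fin N) (Fin N) ℂ)) Matrix.isHermitian_one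
      (T := T) (B := 1) (a := ε * η ^ 2 / (100 * ‖O‖)) one_pos hone (by positivity) hδ0 hT0 (by
        refine le_trans ?_ hT'
        calc _ = 20000 * Lc.l1 ^ 4 * (‖O‖ ^ 2 * Real.log (2 / δ) / (ε ^ 2 * η ^ 4)) := by
              field_simp; ring
          _ ≤ _ := by gcongr; linarith)
    rw [SingleAncilla.trace_mul_ofVec_mul] at hc1 hc2
    rw [Matrix.one_mulVec] at hc2
    rw [SingleAncilla.EvolutionLCU.singleAncillaLCU, pow_two,
      ENNReal.ofReal_mul (by linarith [hδ.2])]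
    have : ∀ {O' : Matrix (Fin N) (Fin N) ℂ} (hO' : O'.IsHermitian), MeasureTheory.SFinite
        (Lc.expectationObservable hA (SingleAncilla.QState.ofVec ψ₀ hψ₀) hO' T) := by
      intro O' hO'
      rw [SingleAncilla.EvolutionLCU.expectationObservable]
      infer_instance
    -- The calls are independent, so both estimates are accurate with probability at least `(1 -
    -- δ)²`; on that rectangle the quotient bound is deterministic.
    refine (mul_le_mul' hc1 hc2).trans ?_
    rw [← MeasureTheory.Measure.prod_prod]
    refine MeasureTheory.measure_mono ?_
    rintro ⟨μ, l⟩ ⟨hμ, hl⟩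
    rw [hγe] at hM
    exact g.abs_div_sub_le hψ₀ hA hO hΔ.le ht hε0 hε.2 hεO hη0 hη1 hvψ hlam0 hat htΔ hM hμ hl
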